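/- Let $(X,d,\mu)$ be a metric measure space: $(X,d)$ is a metric space and $\mu$ is a Borel measure with $0<\mu(B(x,r))<\infty$ for every open ball $B(x,r)$, $x\in X$, $r\in(0,\infty)$. **Exponents.** A variable exponent is a measurable function $p:X\to(0,\infty]$ with $p^-:=\operatorname{ess\,inf}_X p>0$; it is bounded ($p\in\mathcal P_b(X)$) if $\operatorname{ess\,sup}_X p<\infty$. We write $p\in\mathcal P_b^{\log}(X)$ if $p\in\mathcal P_b(X)$ and $1/p$ is log-Hölder continuous, i.e. there is $C\in(0,\infty)$ with $|1/p(x)-1/p(y)|\le C/\log(e+1/d(x,y))$ for all $x,y\in X$. We write $p_1\ll p_2$ if $\operatorname{ess\,inf}_X(p_2-p_1)>0$. Functions are identified if they agree $\mu$-a.e. **Lebesgue spaces.** $L^{p(\cdot)}(X,\mu)$ consists of the measurable, a.e. finite functions $u$ with $\rho_{p(\cdot)}(\lambda u)<\infty$ for some $\lambda\in(0,\infty)$, where $\rho_{p(\cdot)}(u)=\int_X|u(x)|^{p(x)}\,d\mu(x)$ for $p\in\mathcal P_b(X)$, with the quasi-norm $\|u\|_{L^{p(\cdot)}}=\inf\{\lambda\in(0,\infty):\rho_{p(\cdot)}(u/\lambda)\le1\}$.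 **Hajłasz–Sobolev spaces.** For $s,p\in\mathcal P_b(X)$, a function $g:X\to[0,\infty]$ is a scalar $s(\cdot)$-gradient of $u$ if $|u(x)-u(y)|\le d(x,y)^{s(x)}g(x)+d(x,y)^{s(y)}g(y)$ for all $x,y$ outside some $\mu$-null set. $M^{s(\cdot),p(\cdot)}(X,d,\mu)$ consists of all $u\in L^{p(\cdot)}(X,\mu)$ that have a scalar $s(\cdot)$-gradient in $L^{p(\cdot)}(X,\mu)$, with the quasi-norm $\|u\|_{M^{s(\cdot),p(\cdot)}}=\|u\|_{L^{p(\cdot)}}+\inf_g\|g\|_{L^{p(\cdot)}}$, the infimum being over all measurable scalar $s(\cdot)$-gradients $g$ of $u$. **Theorem.** Let $(X,d)$ be totally bounded, and let $Q\in\mathcal P_b^{\log}(X)$ be such that $\mu$ is lower Ahlfors $Q(\cdot)$-regular: there is $b\in(0,\infty)$ with $\mu(B(x,r))\ge b\,r^{Q(x)}$ for all $x\in X$ and $r\in(0,1]$. Let $p,s\in\mathcal P_b^{\log}(X)$ satisfy $sp\ll Q$, and put $\gamma:=Qp/(Q-sp)$. Then for every $q\in\mathcal P_b(X)$ with $p\le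 q\ll\gamma$ ($p\le q$ a.e. suffices) there is a compact embedding $$M^{s(\cdot),p(\cdot)}(X,d,\mu)\hookrightarrow\hookrightarrow L^{q(\cdot)}(X,\mu),$$ that is: $M^{s(\cdot),p(\cdot)}(X,d,\mu)\subseteq L^{q(\cdot)}(X,\mu)$; there is $C<\infty$ with $\|u\|_{L^{q(\cdot)}}\le C\|u\|_{M^{s(\cdot),p(\cdot)}}$ for all $u\in M^{s(\cdot),p(\cdot)}(X,d,\mu)$; and every bounded sequence in $M^{s(\cdot),p(\cdot)}(X,d,\mu)$ has a subsequence converging in $L^{q(\cdot)}(X,\mu)$ to an element of $L^{q(\cdot)}(X,\mu)$. -/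

import Mathlib

open MeasureTheory Filter
open scoped ENNReal Topology

namespace VarExp

noncomputable section

/-- The integrand `φ_p(t)` of the variable exponent modular: `t ^ p` if `p < ∞`, and for `p = ∞`
it is `0` if `t ≤ 1` and `∞` if `t > 1`. -/
def phi (p t : ℝ≥0∞) : ℝ≥0∞ :=
  if p = ∞ then (if t ≤ 1 then 0 else ∞) else t ^ p.toReal

section Measure

variable {X : Type*} [MeasurableSpace X]

/-- The class `𝒫(X)` of variable exponents: measurable functions `p : X → (0, ∞]` whose essential
infimum is positive. -/
structure IsExponent (μ : Measure X) (p : X → ℝ≥0∞) : Prop where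
  measurable : Measurable p
  pos : ∀ x, 0 < p x
  essInf_pos : 0 < essInf p μ

/-- The class `𝒫_b(X)` of essentially bounded variable exponents. -/
structure IsBddExponent (μ : Measure X) (p : X → ℝ≥0∞) : Prop extends IsExponent μ p where
  essSup_lt_top : essSup p μ < ∞

/-- The relation `p₁ ≪ p₂`: the essential infimum of `p₂ - p₁` is positive. (Subtraction is
truncated at `0`, which does not affect positivity of the essential infimum.) -/
def MuchLess (μ : Measure X) (p₁ p₂ : X → ℝ≥0∞) : Prop :=
  0 < essInf (fun x => p₂ x - p₁ x) μ

/-- The modular `ρ_{p(·)}(f) = ∫ φ_{p(x)}(f(x)) dμ(x)` of a non-negative function `f`. -/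
def modular (μ : Measure X) (p : X → ℝ≥0∞) (f : X → ℝ≥0∞) : ℝ≥0∞ :=
  ∫⁻ x, phi (p x) (f x) ∂μ

/-- The Luxemburg quasi-norm of a non-negative function `f`, with values in `[0, ∞]`. -/
def luxNorm (μ : Measure X) (p : X → ℝ≥0∞) (f : X → ℝ≥0∞) : ℝ≥0∞ :=
  sInf {t : ℝ≥0∞ | 0 < t ∧ t < ∞ ∧ modular μ p (fun x => f x / t) ≤ 1}

/-- The variable exponent Lebesgue space `L^{p(·)}(X, μ)`, as a set of a.e.-classes of measurable
a.e.-finite functions `u`: those with `ρ_{p(·)}(t u) < ∞` for some `t ∈ (0, ∞)`. -/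
def Lvar (μ : Measure X) (p : X → ℝ≥0∞) : Set (X →ₘ[μ] ℝ) :=
  {u | ∃ t : ℝ≥0∞, 0 < t ∧ t < ∞ ∧ modular μ p (fun x => t * ‖u x‖ₑ) < ∞}

/-- The quasi-norm of `L^{p(·)}(X, μ)`. -/
def LvarNorm (μ : Measure X) (p : X → ℝ≥0∞) (u : X →ₘ[μ] ℝ) : ℝ≥0∞ :=
  luxNorm μ p (fun x => ‖u x‖ₑ)

/-- The compact embedding `A ↪↪ B` of two quasi-normed spaces of (a.e.-classes of) functions, with
quasi-norms `NA` and `NB`: `A ⊆ B`, the inclusion is bounded, and every sequence that is bounded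
in `A` has a subsequence that converges in `B`. -/
def CompactEmbedding {μ : Measure X} (A : Set (X →ₘ[μ] ℝ)) (NA : (X →ₘ[μ] ℝ) → ℝ≥0∞)
    (B : Set (X →ₘ[μ] ℝ)) (NB : (X →ₘ[μ] ℝ) → ℝ≥0∞) : Prop :=
  A ⊆ B ∧
  (∃ C : ℝ≥0∞, C < ∞ ∧ ∀ u ∈ A, NB u ≤ C * NA u) ∧
  (∀ u : ℕ → (X →ₘ[μ] ℝ), (∀ n, u n ∈ A) → (∃ K : ℝ≥0∞, K < ∞ ∧ ∀ n, NA (u n) ≤ K) →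
    ∃ v ∈ B, ∃ k : ℕ → ℕ, StrictMono k ∧ Tendsto (fun n => NB (u (k n) - v)) atTop (𝓝 0))

end Measure

section MetricMeasure

variable {X : Type*} [MetricSpace X]

/-- Local log-Hölder continuity (with a constant uniform over all pairs of points). -/
def LocLogHolder (f : X → ℝ) : Prop :=
  ∃ C : ℝ, 0 < C ∧ ∀ x y : X, |f x - f y| ≤ C / Real.log (Real.exp 1 + 1 / dist x y)

variable [MeasurableSpace X]

/-- The class `𝒫_b^log(X)`: bounded exponents `p` such that `1 / p` is locally log-Hölder
continuous. -/
structure IsLogBddExponent (μ : Measure X) (p : X → ℝ≥0∞) : Prop extends IsBddExponent μ p where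
  logHolder : LocLogHolder (fun x => ((p x)⁻¹).toReal)

/-- Every open ball has positive and finite measure. -/
def BallsPosFinite (μ : Measure X) : Prop :=
  ∀ (x : X) (r : ℝ), 0 < r → 0 < μ (Metric.ball x r) ∧ μ (Metric.ball x r) < ∞

/-- Lower Ahlfors `Q(·)`-regularity: `μ(B(x, r)) ≥ b r^{Q(x)}` for all `x` and `r ∈ (0, 1]`. -/
def LowerAhlfors (μ : Measure X) (Q : X → ℝ≥0∞) : Prop :=
  ∃ b : ℝ, 0 < b ∧ ∀ (x : X) (r : ℝ), 0 < r → r ≤ 1 →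
    ENNReal.ofReal (b * r ^ (Q x).toReal) ≤ μ (Metric.ball x r)

/-- `g : X → [0, ∞]` is a scalar `s(·)`-gradient of `u`: off a null set `N`,
`|u(x) - u(y)| ≤ d(x,y)^{s(x)} g(x) + d(x,y)^{s(y)} g(y)`. The condition does not depend on the
representative of `u`. -/
def IsScalarGradient (μ : Measure X) (s : X → ℝ≥0∞) (u : X →ₘ[μ] ℝ) (g : X → ℝ≥0∞) : Prop :=
  ∃ N : Set X, μ N = 0 ∧ ∀ x ∉ N, ∀ y ∉ N,
    ‖u x - u y‖ₑ ≤ edist x y ^ (s x).toReal * g x + edist x y ^ (s y).toReal * g y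

/-- The homogeneous Hajłasz-Sobolev quasi-seminorm: the infimum of `‖g‖_{L^{p(·)}}` over the
measurable scalar `s(·)`-gradients `g` of `u` (it is `∞` if there are none of finite norm). -/
def homNorm (μ : Measure X) (s p : X → ℝ≥0∞) (u : X →ₘ[μ] ℝ) : ℝ≥0∞ :=
  sInf {t : ℝ≥0∞ | ∃ g : X → ℝ≥0∞, Measurable g ∧ IsScalarGradient μ s u g ∧ t = luxNorm μ p g}

/-- The Hajłasz-Sobolev space `M^{s(·),p(·)}(X, d, μ)`. -/
def Mspace (μ : Measure X) (s p : X → ℝ≥0∞) : Set (X →ₘ[μ] ℝ) :=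
  {u | homNorm μ s p u < ∞ ∧ u ∈ Lvar μ p}

/-- The quasi-norm of `M^{s(·),p(·)}(X, d, μ)`. -/
def MNorm (μ : Measure X) (s p : X → ℝ≥0∞) (u : X →ₘ[μ] ℝ) : ℝ≥0∞ :=
  LvarNorm μ p u + homNorm μ s p u

end MetricMeasure

end

end VarExp

/-! The heart is a pointwise self-improvement. Normalise `u` and a gradient `g` to have modular at
most 1, put `h = max g |u|`, and fix `x`. By Chebyshev, near `x` the set `{h > 2^j}` has measure at
most `2 * 2^(-jp)`, while a ball about `x` of radius `A * 2^(-jp/Q)` has measure at least `3 *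
2^(-jp)` by lower regularity. So each such ball contains a point where `h ≤ 2^j`. Consecutive points
of this kind are at distance `≲ 2^(-jp/Q)`, and the gradient inequality makes `u` change by `≲
2^(jθ)` between them, with `θ = 1 - sp/Q`. The geometric sum gives `|u| ≤ C * max 1 h ^ θ` a.e.
(`abs_le_of_chain`, `exists_enorm_le_mul_max_rpow`).

Since `θγ = p`, raising this to a power `q + η` below `γ` bounds `|u|^(q+η)` by `1 + g^p + |u|^p`,
which is integrable because `μ` is finite. With variable exponents, log-Hölder continuity allows `p`
and `s` to be replaced near `x` by `τ p(x)` and `τ s(x)`, with `τ < 1` close to 1. The uniform gap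
`q ≪ γ` pays for both `τ` and `η` (`exponent_gap`).

For compactness, the functions `arctan u_n` are uniformly close in `L¹` to bounded step functions on
a finite partition into small cells, hence form a totally bounded set (`totallyBounded_arctan`).
This yields a subsequence converging a.e. The uniform bound in the exponent `q + η` turns this into
modular, and then norm, convergence in the exponent `q` by Vitali's argument
(`tendsto_lintegral_rpow_zero`). -/

namespace VarExp

/-! ### The chaining estimate at a fixed point, with constant exponents. -/

section Chain

variable {X : Type*} [MetricSpace X] [MeasurableSpace X]

/-- Chaining along a sequence of points around `x`, one for each level set of `h`. -/
lemma abs_le_of_chain {μ : Measure X} {x : X} {b Q p s r A D : ℝ} {k₀ : ℕ} {U : X → ℝ}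
    {h : X → ℝ≥0∞} {N : Set X} (hQ : 0 < Q) (hp : 0 < p) (hr : r ≤ 1)
    (hs : 0 < s) (hA : 1 ≤ A) (hbA : 3 ≤ b * A ^ Q)
    (hball : ∀ ρ : ℝ, 0 < ρ → ρ ≤ 1 → ENNReal.ofReal (b * ρ ^ Q) ≤ μ (Metric.ball x ρ))
    (htail : ∀ M : ℝ, 1 ≤ M →
      μ ({y | dist y x < r ∧ ENNReal.ofReal M < h y} ∪ N) ≤ ENNReal.ofReal (2 * M ^ (-p)))
    (hosc : ∀ y z : X, y ∉ N → z ∉ N → dist y x < r → dist z x < r → dist y z ≤ 1 →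
      ∀ M : ℝ, 0 ≤ M → h y ≤ ENNReal.ofReal M → h z ≤ ENNReal.ofReal M →
        |U y - U z| ≤ 2 * M * dist y z ^ s)
    (hU : ∀ (y : X) (M : ℝ), 0 ≤ M → h y ≤ ENNReal.ofReal M → |U y| ≤ M)
    (hk₀ : 2 * (A * 2 ^ (-(k₀ * (p / Q)))) ≤ r) (hθ : 0 < 1 - p / Q * s)
    (hD₀ : 2 ^ k₀ ≤ D) (hD : 4 * (2 * A) ^ s ≤ D * (2 ^ (1 - p / Q * s) - 1))
    (j : ℕ) (hj : k₀ ≤ j) (y : X) (hy : y ∉ N) (hyx : dist y x < A * 2 ^ (-(j * (p / Q))))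
    (hhy : h y ≤ ENNReal.ofReal (2 ^ j)) :
    |U y| ≤ D * 2 ^ (j * (1 - p / Q * s)) := by
  have hβ : 0 < p / Q := div_pos hp hQ
  have hρ : ∀ i : ℕ, k₀ ≤ i → 2 * (A * (2 : ℝ) ^ (-(i * (p / Q)))) ≤ r := by
    intro i hi
    refine le_trans ?_ hk₀
    have : (k₀ : ℝ) ≤ i := by exact_mod_cast hi
    gcongr
    norm_num
  have hρ0 : ∀ i : ℕ, 0 < A * (2 : ℝ) ^ (-(i * (p / Q))) := fun i => by positivity
  have hDpos : 0 < D := lt_of_lt_of_le (by positivity) hD₀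
  induction j, hj using Nat.le_induction generalizing y with
  | base =>
    refine (hU y _ (by positivity) hhy).trans (hD₀.trans ?_)
    refine le_mul_of_one_le_right hDpos.le (Real.one_le_rpow (by norm_num) (by positivity))
  | succ j hj ih =>
    set ρ : ℝ := A * (2 : ℝ) ^ (-(j * (p / Q))) with hρdef
    have hρr := hρ j hj
    have hρpos : 0 < ρ := hρ0 j
    -- Otherwise the whole ball is bad, and the regularity bound `3 * 2^(-jp)` would not exceed the
    -- tail bound `2 * 2^(-jp)`.
    obtain ⟨z, hzx, hzN, hhz⟩ : ∃ z, dist z x < ρ ∧ z ∉ N ∧ h z ≤ ENNReal.ofReal (2 ^ j) := by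
      by_contra! hcon
      have hsub : Metric.ball x ρ ⊆ {y | dist y x < r ∧ ENNReal.ofReal (2 ^ j) < h y} ∪ N := by
        intro z hz
        by_cases hzN : z ∈ N
        · exact Or.inr hzN
        · have hz' : dist z x < ρ := hz
          exact Or.inl ⟨by linarith, hcon z hz' hzN⟩
      have h1 := (hball ρ hρpos (by linarith)).trans
        ((measure_mono hsub).trans (htail (2 ^ j) (one_le_pow₀ (by norm_num))))
      have h2 : b * ρ ^ Q = b * A ^ Q * ((2 : ℝ) ^ j) ^ (-p) := by
        rw [hρdef, Real.mul_rpow (by positivity) (by positivity), ← Real.rpow_mul (by norm_num),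
          ← Real.rpow_natCast, ← Real.rpow_mul (by norm_num), mul_assoc]
        congr 3
        field_simp
      rw [ENNReal.ofReal_le_ofReal_iff (by positivity), h2] at h1
      have h3 : 0 < ((2 : ℝ) ^ j) ^ (-p) := by positivity
      nlinarith
    have hyρ : dist y x < ρ := by
      refine hyx.trans_le ?_
      rw [hρdef]
      gcongr
      · norm_num
      · simp
    have hyz : dist y z ≤ 2 * ρ := by
      have := dist_triangle_right y z x
      linarith
    have h2j : ENNReal.ofReal ((2 : ℝ) ^ j) ≤ ENNReal.ofReal (2 ^ (j + 1)) := by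
      gcongr
      · norm_num
      · simp
    have hdiff := hosc y z hy hzN (by linarith) (by linarith) (by linarith) (2 ^ (j + 1))
      (by positivity) hhy (hhz.trans h2j)
    have hz := ih z hzN hzx hhz
    set θ := 1 - p / Q * s with hθdef
    -- The exponents match: `2^j * (2^(-jp/Q))^s = 2^(jθ)`. By `hD` this increment is at most `D *
    -- 2^(jθ) * (2^θ - 1)`, exactly the growth of the claimed bound from `j` to `j + 1`.
    have hstep : 2 * (2 : ℝ) ^ (j + 1) * dist y z ^ s ≤ 4 * (2 * A) ^ s * 2 ^ (j * θ) := by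
      have e1 : dist y z ^ s ≤ (2 * ρ) ^ s := Real.rpow_le_rpow dist_nonneg hyz hs.le
      have e2 : (2 * ρ) ^ s = (2 * A) ^ s * 2 ^ (-(j * (p / Q)) * s) := by
        rw [hρdef, ← mul_assoc, Real.mul_rpow (by positivity) (by positivity),
          ← Real.rpow_mul (by norm_num)]
      have e3 : (2 : ℝ) ^ (j * θ) = 2 ^ j * 2 ^ (-(j * (p / Q)) * s) := by
        rw [← Real.rpow_natCast, ← Real.rpow_add (by norm_num), hθdef]
        congr 1
        ring
      calc 2 * (2 : ℝ) ^ (j + 1) * dist y z ^ s ≤ 2 * (2 : ℝ) ^ (j + 1) * (2 * ρ) ^ s := by gcongr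
        _ = 4 * (2 * A) ^ s * 2 ^ (j * θ) := by rw [e2, e3]; ring
    have hsum : (2 : ℝ) ^ (((j + 1 : ℕ) : ℝ) * θ) = 2 ^ (j * θ) * 2 ^ θ := by
      rw [← Real.rpow_add (by norm_num)]
      congr 1
      push_cast
      ring
    have habs : |U y| ≤ |U z| + |U y - U z| := by
      have := abs_add_le (U z) (U y - U z)
      simpa using this
    have hpos : 0 < (2 : ℝ) ^ (j * θ) := by positivity
    rw [hsum]
    nlinarith

/-- The pointwise form of the Sobolev embedding at a single point. -/
lemma abs_le_mul_max_rpow {μ : Measure X} {x : X} {b Q p s r A D : ℝ} {k₀ : ℕ} {U : X → ℝ}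
    {h : X → ℝ≥0∞} {N : Set X} (hQ : 0 < Q) (hp : 0 < p) (hr : r ≤ 1)
    (hs : 0 < s) (hA : 1 ≤ A) (hbA : 3 ≤ b * A ^ Q)
    (hball : ∀ ρ : ℝ, 0 < ρ → ρ ≤ 1 → ENNReal.ofReal (b * ρ ^ Q) ≤ μ (Metric.ball x ρ))
    (htail : ∀ M : ℝ, 1 ≤ M →
      μ ({y | dist y x < r ∧ ENNReal.ofReal M < h y} ∪ N) ≤ ENNReal.ofReal (2 * M ^ (-p)))
    (hosc : ∀ y z : X, y ∉ N → z ∉ N → dist y x < r → dist z x < r → dist y z ≤ 1 →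
      ∀ M : ℝ, 0 ≤ M → h y ≤ ENNReal.ofReal M → h z ≤ ENNReal.ofReal M →
        |U y - U z| ≤ 2 * M * dist y z ^ s)
    (hU : ∀ (y : X) (M : ℝ), 0 ≤ M → h y ≤ ENNReal.ofReal M → |U y| ≤ M)
    (hk₀ : 2 * (A * 2 ^ (-(k₀ * (p / Q)))) ≤ r) (hθ : 0 < 1 - p / Q * s)
    (hD₀ : 2 ^ k₀ ≤ D) (hD : 4 * (2 * A) ^ s ≤ D * (2 ^ (1 - p / Q * s) - 1))
    (hx : x ∉ N) (hhx : h x ≠ ∞) :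
    |U x| ≤ D * 2 ^ (k₀ + 1) * max 1 (h x).toReal ^ (1 - p / Q * s) := by
  have key := fun j hj => abs_le_of_chain hQ hp hr hs hA hbA hball htail hosc hU hk₀ hθ hD₀ hD
    j hj x hx (by rw [dist_self]; positivity)
  set θ := 1 - p / Q * s with hθdef
  have hθ1 : θ ≤ 1 := by
    have : 0 ≤ p / Q * s := by positivity
    linarith
  have hDpos : 0 < D := lt_of_lt_of_le (by positivity) hD₀
  set H := (h x).toReal with hH
  have hhH : h x = ENNReal.ofReal H := (ENNReal.ofReal_toReal hhx).symm
  -- The chain starts only at level `k₀`, where the balls fit inside radius `r`. Smaller values of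
  -- `h x` are absorbed in the constant; larger ones use the dyadic level just above `h x`.
  by_cases hle : H ≤ 2 ^ k₀
  · refine (key k₀ le_rfl (by rw [hhH]; exact ENNReal.ofReal_le_ofReal hle)).trans ?_
    have h1 : (2 : ℝ) ^ (k₀ * θ) ≤ 2 ^ (k₀ + 1) := by
      rw [← Real.rpow_natCast]
      refine Real.rpow_le_rpow_of_exponent_le (by norm_num) ?_
      push_cast
      nlinarith [(Nat.cast_nonneg k₀ : (0 : ℝ) ≤ k₀)]
    have h2 : 1 ≤ max 1 H ^ θ := Real.one_le_rpow (le_max_left _ _) hθ.le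
    calc D * (2 : ℝ) ^ (k₀ * θ) ≤ D * 2 ^ (k₀ + 1) := by gcongr
      _ ≤ _ := le_mul_of_one_le_right (by positivity) h2
  · have hlt : (2 : ℝ) ^ k₀ < H := not_le.1 hle
    have hH1 : 1 ≤ H := (one_le_pow₀ (by norm_num)).trans hlt.le
    obtain ⟨n, hn1, hn2⟩ := exists_nat_pow_near hH1 (by norm_num : (1 : ℝ) < 2)
    have hkn : k₀ < n + 1 := by
      by_contra! hcon
      have : (2 : ℝ) ^ (n + 1) ≤ 2 ^ k₀ := pow_le_pow_right₀ (by norm_num) hcon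
      linarith
    refine (key (n + 1) hkn.le (by rw [hhH]; exact ENNReal.ofReal_le_ofReal hn2.le)).trans ?_
    have h1 : (2 : ℝ) ^ (((n + 1 : ℕ) : ℝ) * θ) ≤ 2 ^ (k₀ + 1) * H ^ θ := by
      rw [Real.rpow_mul (by norm_num), Real.rpow_natCast]
      calc ((2 : ℝ) ^ (n + 1)) ^ θ ≤ (2 * H) ^ θ := by
            refine Real.rpow_le_rpow (by positivity) ?_ hθ.le
            rw [pow_succ]
            linarith
        _ = 2 ^ θ * H ^ θ := Real.mul_rpow (by norm_num) (by linarith)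
        _ ≤ 2 ^ (k₀ + 1) * H ^ θ := by
            gcongr
            calc (2 : ℝ) ^ θ ≤ 2 ^ (1 : ℝ) := Real.rpow_le_rpow_of_exponent_le (by norm_num) hθ1
              _ = 2 ^ 1 := by norm_num
              _ ≤ 2 ^ (k₀ + 1) := pow_le_pow_right₀ (by norm_num) (by omega)
    rw [max_eq_right hH1, mul_assoc]
    gcongr

end Chain

/-! ### Uniform bounds and local almost constancy of exponents. -/

section Exponents

lemma MuchLess.exists_pos {X : Type*} [MeasurableSpace X] {μ : Measure X} {p₁ p₂ : X → ℝ≥0∞}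
    (h : MuchLess μ p₁ p₂) :
    ∃ δ : ℝ, 0 < δ ∧ ∀ᵐ x ∂μ, ENNReal.ofReal δ ≤ p₂ x - p₁ x := by
  have h0 : 0 < essInf (fun x => p₂ x - p₁ x) μ := h
  obtain ⟨c, hc0, hc⟩ := exists_between h0
  refine ⟨c.toReal, ENNReal.toReal_pos hc0.ne' hc.ne_top, ?_⟩
  filter_upwards [ae_lt_of_lt_essInf hc] with x hx
  rw [ENNReal.ofReal_toReal hc.ne_top]
  exact hx.le

lemma IsBddExponent.ae_bounds {X : Type*} [MeasurableSpace X] {μ : Measure X} {p : X → ℝ≥0∞}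
    (h : IsBddExponent μ p) :
    ∃ a b : ℝ, 0 < a ∧ a ≤ b ∧
      ∀ᵐ x ∂μ, p x ≠ ∞ ∧ a ≤ (p x).toReal ∧ (p x).toReal ≤ b := by
  obtain ⟨c, hc0, hc⟩ := exists_between h.essInf_pos
  obtain ⟨d, hd0, hd⟩ := exists_between h.essSup_lt_top
  refine ⟨c.toReal, max c.toReal d.toReal, ENNReal.toReal_pos hc0.ne' hc.ne_top,
    le_max_left _ _, ?_⟩
  filter_upwards [ae_lt_of_lt_essInf hc, ae_lt_of_essSup_lt hd0] with x hx1 hx2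
  have hx : p x ≠ ∞ := (hx2.trans hd).ne
  exact ⟨hx, ENNReal.toReal_mono hx hx1.le, (ENNReal.toReal_mono hd.ne hx2.le).trans
    (le_max_right _ _)⟩

variable {X : Type*} [MetricSpace X]

lemma LocLogHolder.exists_dist {f : X → ℝ} (hf : LocLogHolder f) {ε : ℝ} (hε : 0 < ε) :
    ∃ r : ℝ, 0 < r ∧ ∀ x y : X, dist x y < r → |f x - f y| ≤ ε := by
  obtain ⟨C, hC, h⟩ := hf
  -- This radius makes `log (1 / dist x y)` at least `C / ε`.
  refine ⟨Real.exp (-(C / ε)), Real.exp_pos _, fun x y hxy => ?_⟩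
  rcases eq_or_ne x y with rfl | hne
  · simpa using hε.le
  have hd : 0 < dist x y := dist_pos.2 hne
  have hlog : C / ε ≤ Real.log (Real.exp 1 + 1 / dist x y) := by
    rw [Real.le_log_iff_exp_le (by positivity)]
    have h1 : Real.exp (C / ε) ≤ 1 / dist x y := by
      rw [le_div_iff₀ hd, ← le_div_iff₀' (Real.exp_pos _), one_div, ← Real.exp_neg]
      exact hxy.le
    have := Real.exp_pos 1
    linarith
  refine (h x y).trans ?_
  have hCε : 0 < C / ε := by positivity
  rw [div_le_iff₀ (hCε.trans_le hlog)]
  rwa [div_le_iff₀' hε] at hlog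

variable [MeasurableSpace X]

lemma BallsPosFinite.exists_dist_lt {μ : Measure X} (hμ : BallsPosFinite μ) {P : X → Prop}
    (hP : ∀ᵐ x ∂μ, P x) (x : X) {r : ℝ} (hr : 0 < r) : ∃ y, dist x y < r ∧ P y := by
  by_contra! hcon
  refine (hμ x r hr).1.ne' (measure_mono_null ?_ (ae_iff.1 hP))
  intro y hy
  exact hcon y (by rwa [dist_comm])

/-- A log-Hölder exponent is bounded above and below everywhere, and uniformly almost constant
on small balls. -/
lemma IsLogBddExponent.bounds {μ : Measure X} (hμ : BallsPosFinite μ) {p : X → ℝ≥0∞}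
    (h : IsLogBddExponent μ p) :
    (∃ a b : ℝ, 0 < a ∧ a ≤ b ∧ ∀ x, p x ≠ ∞ ∧ a ≤ (p x).toReal ∧ (p x).toReal ≤ b) ∧
    (∀ τ : ℝ, 0 < τ → τ < 1 →
      ∃ r : ℝ, 0 < r ∧ ∀ x y, dist x y < r → τ * (p x).toReal ≤ (p y).toReal) := by
  obtain ⟨a, b, ha, hab, hae⟩ := h.toIsBddExponent.ae_bounds
  have hb : 0 < b := ha.trans_le hab
  -- Almost everywhere bounds hold everywhere: each ball has positive measure, so it contains a
  -- point where they hold, and continuity of `1 / p` carries them to the centre up to any `ε`.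
  have hinv : ∀ x, b⁻¹ ≤ ((p x)⁻¹).toReal ∧ ((p x)⁻¹).toReal ≤ a⁻¹ := by
    intro x
    have key : ∀ ε : ℝ, 0 < ε → b⁻¹ ≤ ((p x)⁻¹).toReal + ε ∧ ((p x)⁻¹).toReal ≤ a⁻¹ + ε := by
      intro ε hε
      obtain ⟨r, hr, hdist⟩ := h.logHolder.exists_dist hε
      obtain ⟨y, hy, -, hy1, hy2⟩ := hμ.exists_dist_lt hae x hr
      have h1 := abs_le.1 (hdist x y hy)
      have hy0 : 0 < (p y).toReal := ha.trans_le hy1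
      have h2 : ((p y)⁻¹).toReal ≤ a⁻¹ := by
        rw [ENNReal.toReal_inv]
        exact inv_anti₀ ha hy1
      have h3 : b⁻¹ ≤ ((p y)⁻¹).toReal := by
        rw [ENNReal.toReal_inv]
        exact inv_anti₀ hy0 hy2
      constructor <;> linarith [h1.1, h1.2]
    exact ⟨le_of_forall_pos_le_add fun ε hε => (key ε hε).1,
      le_of_forall_pos_le_add fun ε hε => (key ε hε).2⟩
  have hbd : ∀ x, p x ≠ ∞ ∧ a ≤ (p x).toReal ∧ (p x).toReal ≤ b := by
    intro x
    obtain ⟨h1, h2⟩ := hinv x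
    have hbi : 0 < b⁻¹ := inv_pos.2 hb
    have htop : p x ≠ ∞ := by
      intro hx
      rw [hx] at h1
      simp only [ENNReal.inv_top, ENNReal.toReal_zero] at h1
      linarith
    rw [ENNReal.toReal_inv] at h1 h2
    have hpos : 0 < (p x).toReal := ENNReal.toReal_pos (h.pos x).ne' htop
    exact ⟨htop, (inv_le_inv₀ hpos ha).1 h2, (inv_le_inv₀ hb hpos).1 h1⟩
  refine ⟨⟨a, b, ha, hab, hbd⟩, fun τ hτ hτ1 => ?_⟩
  -- Chosen because `(τP)⁻¹ = P⁻¹ + (τ⁻¹ - 1) / P` and `P ≤ b`.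
  have hε : 0 < (τ⁻¹ - 1) / b := div_pos (sub_pos.2 (one_lt_inv₀ hτ |>.2 hτ1)) hb
  obtain ⟨r, hr, hdist⟩ := h.logHolder.exists_dist hε
  refine ⟨r, hr, fun x y hxy => ?_⟩
  obtain ⟨-, hx1, hx2⟩ := hbd x
  obtain ⟨-, hy1, hy2⟩ := hbd y
  have h1 := (abs_le.1 (hdist x y hxy)).1
  simp only [ENNReal.toReal_inv] at h1
  set P := (p x).toReal
  set P' := (p y).toReal
  have hP : 0 < P := ha.trans_le hx1
  have hP' : 0 < P' := ha.trans_le hy1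
  have h2 : (τ⁻¹ - 1) / b ≤ (τ⁻¹ - 1) / P :=
    div_le_div_of_nonneg_left (sub_pos.2 (one_lt_inv₀ hτ |>.2 hτ1)).le hP hx2
  have h3 : P'⁻¹ ≤ (τ * P)⁻¹ := by
    have : (τ * P)⁻¹ = P⁻¹ + (τ⁻¹ - 1) / P := by field_simp; ring
    linarith
  exact (inv_le_inv₀ hP' (by positivity)).1 h3

lemma BallsPosFinite.isFiniteMeasure {μ : Measure X} (hμ : BallsPosFinite μ)
    (hX : TotallyBounded (Set.univ : Set X)) : IsFiniteMeasure μ := by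
  refine ⟨?_⟩
  rcases isEmpty_or_nonempty X with hE | ⟨⟨x⟩⟩
  · simp [Set.univ_eq_empty_iff.2 hE]
  · obtain ⟨R, hR⟩ := hX.isBounded.subset_ball x
    refine (measure_mono (hR.trans (Metric.ball_subset_ball (le_max_left R 1)))).trans_lt
      (hμ x _ (by positivity)).2

end Exponents

/-! ### Oscillation and tail estimates. -/

section Gradient

variable {X : Type*} [MetricSpace X]

/-- The pointwise gradient inequality for functions with values in `ℝ`, off an exceptional set. -/
def GradientOff (N : Set X) (S : X → ℝ) (u : X → ℝ) (g : X → ℝ≥0∞) : Prop :=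
  ∀ x ∉ N, ∀ y ∉ N, ‖u x - u y‖ₑ ≤ edist x y ^ S x * g x + edist x y ^ S y * g y

lemma GradientOff.abs_sub_le {N : Set X} {S : X → ℝ} {u : X → ℝ} {g : X → ℝ≥0∞}
    (h : GradientOff N S u g) {y z : X} (hy : y ∉ N) (hz : z ∉ N) {s M : ℝ} (hs : 0 < s)
    (hsy : s ≤ S y) (hsz : s ≤ S z) (hd : dist y z ≤ 1) (hM : 0 ≤ M)
    (hgy : g y ≤ ENNReal.ofReal M) (hgz : g z ≤ ENNReal.ofReal M) :
    |u y - u z| ≤ 2 * M * dist y z ^ s := by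
  have hd1 : edist y z ≤ 1 := by
    rw [edist_dist]
    exact ENNReal.ofReal_le_one.2 hd
  have h1 : ‖u y - u z‖ₑ ≤ ENNReal.ofReal (2 * M * dist y z ^ s) := by
    calc ‖u y - u z‖ₑ ≤ edist y z ^ S y * g y + edist y z ^ S z * g z := h y hy z hz
      _ ≤ edist y z ^ s * ENNReal.ofReal M + edist y z ^ s * ENNReal.ofReal M :=
        add_le_add (mul_le_mul' (ENNReal.rpow_le_rpow_of_exponent_ge hd1 hsy) hgy)
          (mul_le_mul' (ENNReal.rpow_le_rpow_of_exponent_ge hd1 hsz) hgz)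
      _ = ENNReal.ofReal (2 * M * dist y z ^ s) := by
        rw [edist_dist, ENNReal.ofReal_rpow_of_nonneg dist_nonneg hs.le,
          ← ENNReal.ofReal_mul (by positivity), ← ENNReal.ofReal_add (by positivity)
          (by positivity)]
        congr 1
        ring
  rw [Real.enorm_eq_ofReal_abs] at h1
  exact (ENNReal.ofReal_le_ofReal_iff (by positivity)).1 h1

lemma abs_le_of_enorm_le {t M : ℝ} (hM : 0 ≤ M) (h : ‖t‖ₑ ≤ ENNReal.ofReal M) : |t| ≤ M := by
  rw [Real.enorm_eq_ofReal_abs] at h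
  exact (ENNReal.ofReal_le_ofReal_iff hM).1 h

lemma max_rpow_le_add (a b : ℝ≥0∞) (p : ℝ) : max a b ^ p ≤ a ^ p + b ^ p := by
  rcases max_choice a b with h | h <;> rw [h]
  · exact le_self_add
  · exact le_add_self

/-- Chebyshev's inequality with a variable exponent. -/
lemma measure_tail_le {X : Type*} [MeasurableSpace X] {μ : Measure X} {P : X → ℝ}
    {f g : X → ℝ≥0∞} {B N : Set X} (hP : Measurable P) (hf : AEMeasurable f μ)
    (hg : AEMeasurable g μ) (hN : μ N = 0)
    (hfP : ∫⁻ x, f x ^ P x ∂μ ≤ 1) (hgP : ∫⁻ x, g x ^ P x ∂μ ≤ 1) {p : ℝ}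
    (hp : 0 < p) (hpP : ∀ y ∈ B, p ≤ P y) {M : ℝ} (hM : 1 ≤ M) :
    μ ({y | y ∈ B ∧ ENNReal.ofReal M < max (f y) (g y)} ∪ N) ≤ ENNReal.ofReal (2 * M ^ (-p)) := by
  have hM0 : 0 < M := by linarith
  have hF : ∫⁻ x, f x ^ P x + g x ^ P x ∂μ ≤ 2 := by
    rw [lintegral_add_left' (hf.pow hP.aemeasurable), ← one_add_one_eq_two]
    exact add_le_add hfP hgP
  have hMp : 0 < M ^ p := by positivity
  have hsub : {y | y ∈ B ∧ ENNReal.ofReal M < max (f y) (g y)} ⊆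
      {y | ENNReal.ofReal (M ^ p) ≤ f y ^ P y + g y ^ P y} := by
    rintro y ⟨hyB, hy⟩
    have hPy : 0 < P y := hp.trans_le (hpP y hyB)
    calc ENNReal.ofReal (M ^ p) ≤ ENNReal.ofReal (M ^ P y) :=
          ENNReal.ofReal_le_ofReal (Real.rpow_le_rpow_of_exponent_le hM (hpP y hyB))
      _ = ENNReal.ofReal M ^ P y := (ENNReal.ofReal_rpow_of_pos hM0).symm
      _ ≤ max (f y) (g y) ^ P y := ENNReal.rpow_le_rpow hy.le hPy.le
      _ ≤ _ := max_rpow_le_add _ _ _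
  calc μ ({y | y ∈ B ∧ ENNReal.ofReal M < max (f y) (g y)} ∪ N)
      ≤ μ {y | y ∈ B ∧ ENNReal.ofReal M < max (f y) (g y)} + μ N := measure_union_le _ _
    _ ≤ μ {y | ENNReal.ofReal (M ^ p) ≤ f y ^ P y + g y ^ P y} := by
        rw [hN, add_zero]
        exact measure_mono hsub
    _ ≤ (∫⁻ x, f x ^ P x + g x ^ P x ∂μ) / ENNReal.ofReal (M ^ p) := by
        rw [ENNReal.le_div_iff_mul_le (Or.inl (by simpa using hMp)) (Or.inl (by simp)), mul_comm]
        exact mul_meas_ge_le_lintegral₀ ((hf.pow hP.aemeasurable).add (hg.pow hP.aemeasurable)) _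
    _ ≤ 2 / ENNReal.ofReal (M ^ p) := by gcongr
    _ = ENNReal.ofReal (2 * M ^ (-p)) := by
        rw [Real.rpow_neg hM0.le, ← div_eq_mul_inv, ENNReal.ofReal_div_of_pos hMp]
        simp

end Gradient

/-! ### From the chain to a pointwise bound and higher integrability. -/

section HigherIntegrability

variable {X : Type*} [MetricSpace X] [MeasurableSpace X]

/-- The pointwise form of the Sobolev embedding, with a uniform constant. -/
lemma exists_enorm_le_mul_max_rpow {μ : Measure X} {Q P S : X → ℝ} {p₀ s₀ s₁ Q₀ Q₁ b τ r₀ θ₀ : ℝ}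
    (hPm : Measurable P) (hp₀ : 0 < p₀) (hP : ∀ x, p₀ ≤ P x) (hs₀ : 0 < s₀)
    (hS : ∀ x, s₀ ≤ S x ∧ S x ≤ s₁) (hQ₀ : 0 < Q₀) (hQ : ∀ x, Q₀ ≤ Q x ∧ Q x ≤ Q₁) (hQ₀₁ : Q₀ ≤ Q₁)
    (hb : 0 < b) (hball : ∀ (x : X) (ρ : ℝ), 0 < ρ → ρ ≤ 1 →
      ENNReal.ofReal (b * ρ ^ Q x) ≤ μ (Metric.ball x ρ))
    (hτ : 0 < τ) (hτ1 : τ < 1) (hr₀ : 0 < r₀)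
    (hPτ : ∀ x y, dist x y < r₀ → τ * P x ≤ P y) (hSτ : ∀ x y, dist x y < r₀ → τ * S x ≤ S y)
    (hθ₀ : 0 < θ₀) :
    ∃ C : ℝ, 1 ≤ C ∧ ∀ (u : X → ℝ) (g : X → ℝ≥0∞) (N : Set X), AEMeasurable u μ →
      AEMeasurable g μ → μ N = 0 → GradientOff N S u g →
      ∫⁻ x, g x ^ P x ∂μ ≤ 1 → ∫⁻ x, ‖u x‖ₑ ^ P x ∂μ ≤ 1 →
      ∀ x ∉ N, θ₀ ≤ 1 - τ * P x / Q x * (τ * S x) →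
        ‖u x‖ₑ ≤ ENNReal.ofReal C *
          max 1 (max (g x) ‖u x‖ₑ) ^ (1 - τ * P x / Q x * (τ * S x)) := by
  have hQ₁ : 0 < Q₁ := hQ₀.trans_le hQ₀₁
  set r := min r₀ 1 with hrdef
  have hr : 0 < r := lt_min hr₀ one_pos
  -- Enlarges the balls so that `b * A ^ Q x ≥ 3` for all `x`, beating the factor 2 in the tail
  -- bound.
  set A := max 1 ((3 / b) ^ (1 / Q₀)) with hAdef
  have hA : 1 ≤ A := le_max_left _ _
  have hA0 : 0 < A := by linarith
  have hbA : ∀ x, 3 ≤ b * A ^ Q x := by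
    intro x
    have h1 : 3 / b ≤ A ^ Q₀ := by
      calc 3 / b = ((3 / b) ^ (1 / Q₀)) ^ Q₀ := by
            rw [← Real.rpow_mul (by positivity), one_div_mul_cancel hQ₀.ne', Real.rpow_one]
        _ ≤ A ^ Q₀ := Real.rpow_le_rpow (by positivity) (le_max_right _ _) hQ₀.le
    have h2 : A ^ Q₀ ≤ A ^ Q x := Real.rpow_le_rpow_of_exponent_le hA (hQ x).1
    have h3 := h1.trans h2
    rwa [div_le_iff₀' hb] at h3
  -- A lower bound for every rate `τ * P x / Q x`, so that a single `k₀` serves all points.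
  set β₀ := τ * p₀ / Q₁ with hβdef
  have hβ₀ : 0 < β₀ := by positivity
  obtain ⟨k₀, hk₀⟩ : ∃ k₀ : ℕ, ((2 : ℝ) ^ (-β₀)) ^ k₀ < r / (2 * A) :=
    exists_pow_lt_of_lt_one (by positivity)
      (Real.rpow_lt_one_of_one_lt_of_neg (by norm_num) (by linarith))
  have h2θ : 0 < (2 : ℝ) ^ θ₀ - 1 := sub_pos.2 (Real.one_lt_rpow (by norm_num) hθ₀)
  -- The first entry starts the chain; the second dominates each of its increments.
  set D := max (2 ^ k₀) (4 * (2 * A) ^ s₁ / (2 ^ θ₀ - 1)) with hDdef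
  have hD₀ : 2 ^ k₀ ≤ D := le_max_left _ _
  have hD1 : 1 ≤ D := (one_le_pow₀ (by norm_num)).trans hD₀
  refine ⟨D * 2 ^ (k₀ + 1), one_le_mul_of_one_le_of_one_le hD1 (one_le_pow₀ (by norm_num)), ?_⟩
  intro u g N hu hg hN hgrad hgP huP x hxN hθ
  set θ := 1 - τ * P x / Q x * (τ * S x) with hθdef
  have hθpos : 0 < θ := hθ₀.trans_le hθ
  by_cases htop : max (g x) ‖u x‖ₑ = ∞
  · have : max 1 (max (g x) ‖u x‖ₑ) = ∞ := by rw [htop]; simp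
    rw [this, ENNReal.top_rpow_of_pos hθpos, ENNReal.mul_top]
    · exact le_top
    · have : 0 < D * 2 ^ (k₀ + 1) := by positivity
      simpa using this
  have hPx : 0 < P x := hp₀.trans_le (hP x)
  have hSx : 0 < S x := hs₀.trans_le (hS x).1
  have hQx : 0 < Q x := hQ₀.trans_le (hQ x).1
  have hτP : 0 < τ * P x := by positivity
  have hτS : 0 < τ * S x := by positivity
  -- On the ball of radius `r` about `x` one has `P ≥ τ * P x` and `S ≥ τ * S x`. Smaller exponents
  -- are harmless in the estimates used, since levels are at least 1 and distances at most 1.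
  have main := abs_le_mul_max_rpow (μ := μ) (x := x) (b := b) (Q := Q x) (p := τ * P x)
    (s := τ * S x) (r := r) (A := A) (D := D) (k₀ := k₀) (U := u)
    (h := fun y => max (g y) ‖u y‖ₑ) (N := N) hQx hτP (min_le_right _ _) hτS hA (hbA x) (hball x)
    (fun M hM => measure_tail_le (B := {y | dist y x < r}) hPm hg hu.enorm hN hgP huP hτP
      (fun y hy => hPτ x y (by rw [dist_comm]; exact lt_of_lt_of_le hy (min_le_left _ _))) hM)
    (fun y z hy hz hyx hzx hyz M hM hhy hhz => hgrad.abs_sub_le hy hz hτS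
      (hSτ x y (by rw [dist_comm]; exact lt_of_lt_of_le hyx (min_le_left _ _)))
      (hSτ x z (by rw [dist_comm]; exact lt_of_lt_of_le hzx (min_le_left _ _))) hyz hM
      ((le_max_left _ _).trans hhy) ((le_max_left _ _).trans hhz))
    (fun y M hM hhy => abs_le_of_enorm_le hM ((le_max_right _ _).trans hhy))
    (by
      have h1 : (2 : ℝ) ^ (-(k₀ * (τ * P x / Q x))) ≤ ((2 : ℝ) ^ (-β₀)) ^ k₀ := by
        rw [← Real.rpow_natCast, ← Real.rpow_mul (by norm_num)]
        refine Real.rpow_le_rpow_of_exponent_le (by norm_num) ?_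
        have : β₀ ≤ τ * P x / Q x := by
          rw [hβdef]
          gcongr
          · exact hP x
          · exact (hQ x).2
        nlinarith [(Nat.cast_nonneg k₀ : (0 : ℝ) ≤ k₀)]
      have h2 := h1.trans hk₀.le
      rw [le_div_iff₀ (by positivity)] at h2
      linarith)
    hθpos hD₀
    (by
      have h1 : (2 * A) ^ (τ * S x) ≤ (2 * A) ^ s₁ := by
        refine Real.rpow_le_rpow_of_exponent_le (by linarith) ?_
        have := (hS x).2
        nlinarith
      have h2 : (2 : ℝ) ^ θ₀ ≤ 2 ^ θ := Real.rpow_le_rpow_of_exponent_le (by norm_num) hθ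
      have h3 : 4 * (2 * A) ^ s₁ / (2 ^ θ₀ - 1) ≤ D := le_max_right _ _
      rw [div_le_iff₀ h2θ] at h3
      nlinarith)
    hxN htop
  rw [Real.enorm_eq_ofReal_abs]
  rw [Real.enorm_eq_ofReal_abs] at main htop
  refine (ENNReal.ofReal_le_ofReal main).trans ?_
  rw [ENNReal.ofReal_mul (by positivity),
    ← ENNReal.ofReal_rpow_of_pos (lt_of_lt_of_le one_pos (le_max_left _ _))]
  gcongr
  rw [ENNReal.ofReal_max, ENNReal.ofReal_one, ENNReal.ofReal_toReal htop]

end HigherIntegrability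

/-- Integration of a pointwise bound by a power of `max g ‖u‖`. -/
lemma lintegral_rpow_le_of_pointwise {X : Type*} [MeasurableSpace X] {μ : Measure X}
    {P t θ : X → ℝ} {u : X → ℝ} {g : X → ℝ≥0∞} {C t₁ : ℝ} (hC : 1 ≤ C) (hPm : Measurable P)
    (hg : AEMeasurable g μ) (hu : AEMeasurable u μ)
    (hgP : ∫⁻ x, g x ^ P x ∂μ ≤ 1) (huP : ∫⁻ x, ‖u x‖ₑ ^ P x ∂μ ≤ 1)
    (ht : ∀ᵐ x ∂μ, 0 ≤ t x ∧ t x ≤ t₁ ∧ θ x * t x ≤ P x)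
    (hpt : ∀ᵐ x ∂μ, ‖u x‖ₑ ≤ ENNReal.ofReal C * max 1 (max (g x) ‖u x‖ₑ) ^ θ x) :
    ∫⁻ x, ‖u x‖ₑ ^ t x ∂μ ≤ ENNReal.ofReal (C ^ t₁) * (μ Set.univ + 2) := by
  have hg' := hg.pow hPm.aemeasurable
  have hu' := hu.enorm.pow hPm.aemeasurable
  calc ∫⁻ x, ‖u x‖ₑ ^ t x ∂μ
      ≤ ∫⁻ x, ENNReal.ofReal (C ^ t₁) * (1 + (g x ^ P x + ‖u x‖ₑ ^ P x)) ∂μ := by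
        refine lintegral_mono_ae ?_
        filter_upwards [ht, hpt] with x hx hpx
        set H := max (g x) ‖u x‖ₑ with hH
        calc ‖u x‖ₑ ^ t x ≤ (ENNReal.ofReal C * max 1 H ^ θ x) ^ t x :=
              ENNReal.rpow_le_rpow hpx hx.1
          _ = ENNReal.ofReal C ^ t x * max 1 H ^ (θ x * t x) := by
              rw [ENNReal.mul_rpow_of_nonneg _ _ hx.1, ENNReal.rpow_mul]
          _ ≤ ENNReal.ofReal (C ^ t₁) * max 1 H ^ P x := by
              gcongr
              · rw [← ENNReal.ofReal_rpow_of_pos (by linarith)]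
                exact ENNReal.rpow_le_rpow_of_exponent_le (by simpa using hC) hx.2.1
              · exact le_max_left _ _
              · exact hx.2.2
          _ ≤ ENNReal.ofReal (C ^ t₁) * (1 + (g x ^ P x + ‖u x‖ₑ ^ P x)) := by
              gcongr
              refine (max_rpow_le_add _ _ _).trans ?_
              rw [ENNReal.one_rpow]
              gcongr
              exact max_rpow_le_add _ _ _
    _ = ENNReal.ofReal (C ^ t₁) * (μ Set.univ + (∫⁻ x, g x ^ P x ∂μ + ∫⁻ x, ‖u x‖ₑ ^ P x ∂μ)) := by
        rw [lintegral_const_mul'' _ (by fun_prop), lintegral_add_left' (by fun_prop),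
          lintegral_add_left' hg']
        simp
    _ ≤ ENNReal.ofReal (C ^ t₁) * (μ Set.univ + 2) := by
        rw [← one_add_one_eq_two]
        gcongr

/-! ### Finite partitions, step functions and total boundedness in `L¹`. -/

section Compactness

lemma totallyBounded_of_forall_approx {α : Type*} [PseudoMetricSpace α] {s : Set α}
    (h : ∀ ε > 0, ∃ t : Set α, TotallyBounded t ∧ ∀ a ∈ s, ∃ b ∈ t, dist a b < ε) :
    TotallyBounded s := by
  rw [Metric.totallyBounded_iff]
  intro ε hε
  obtain ⟨t, ht, hst⟩ := h (ε / 2) (by positivity)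
  obtain ⟨F, hF, hcov⟩ := Metric.totallyBounded_iff.1 ht (ε / 2) (by positivity)
  refine ⟨F, hF, fun a ha => ?_⟩
  obtain ⟨b, hb, hab⟩ := hst a ha
  obtain ⟨c, hc, hbc⟩ := Set.mem_iUnion₂.1 (hcov hb)
  refine Set.mem_iUnion₂.2 ⟨c, hc, ?_⟩
  have h1 : dist b c < ε / 2 := hbc
  have := dist_triangle a b c
  exact Metric.mem_ball.2 (by linarith)

/-- A totally bounded space has a finite measurable partition into pieces of small diameter. -/
lemma exists_measurable_partition {X : Type*} [MetricSpace X] [MeasurableSpace X] [BorelSpace X]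
    (hX : TotallyBounded (Set.univ : Set X)) {r : ℝ} (hr : 0 < r) :
    ∃ (m : ℕ) (π : X → Fin (m + 1)), Measurable π ∧ ∀ x y, π x = π y → dist x y < r := by
  rcases isEmpty_or_nonempty X with hE | ⟨⟨x₀⟩⟩
  · exact ⟨0, fun _ => 0, measurable_const, fun x => isEmptyElim x⟩
  obtain ⟨t, ht, hcov⟩ := Metric.totallyBounded_iff.1 hX (r / 2) (by positivity)
  obtain ⟨n, f, hf⟩ := ht.fin_embedding
  let e : ℕ → X := fun k => if h : k < n then f ⟨k, h⟩ else x₀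
  have hnear : ∀ x, dist (e (SimpleFunc.nearestPtInd e n x)) x < r / 2 := by
    intro x
    obtain ⟨c, hc, hxc⟩ := Set.mem_iUnion₂.1 (hcov (Set.mem_univ x))
    rw [← hf] at hc
    obtain ⟨⟨k, hk⟩, rfl⟩ := hc
    have hek : e k = f ⟨k, hk⟩ := by simp [e, hk]
    have h1 := SimpleFunc.edist_nearestPt_le e x hk.le
    rw [hek, edist_dist, edist_dist, ENNReal.ofReal_le_ofReal_iff dist_nonneg] at h1
    have h2 : dist x (f ⟨k, hk⟩) < r / 2 := hxc
    rw [dist_comm] at h2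
    exact h1.trans_lt h2
  refine ⟨n, fun x => Fin.ofNat (n + 1) (SimpleFunc.nearestPtInd e n x),
    Measurable.comp (g := fun k => Fin.ofNat (n + 1) k) measurable_from_nat (SimpleFunc.nearestPtInd e n).measurable,
    fun x y hxy => ?_⟩
  have hle : ∀ x, SimpleFunc.nearestPtInd e n x < n + 1 := fun x =>
    Nat.lt_succ_of_le (SimpleFunc.nearestPtInd_le e n x)
  have hxy' := congrArg Fin.val hxy
  simp only [Fin.val_ofNat, Nat.mod_eq_of_lt (hle _)] at hxy'
  have h1 := hnear x
  have h2 := hnear y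
  rw [← hxy'] at h2
  have := dist_triangle_left x y (e (SimpleFunc.nearestPtInd e n x))
  linarith

variable {X : Type*} [MeasurableSpace X] {μ : Measure X} [IsFiniteMeasure μ]

lemma memLp_one_comp_fin {m : ℕ} {π : X → Fin (m + 1)} (hπ : Measurable π)
    (a : Fin (m + 1) → ℝ) : MemLp (fun x => a (π x)) 1 μ :=
  MemLp.of_bound ((measurable_of_finite a).comp hπ).aestronglyMeasurable ‖a‖
    (Eventually.of_forall fun x => norm_le_pi_norm a (π x))

/-- Bounded step functions over a finite partition form a totally bounded set in `L¹`. -/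
lemma totallyBounded_stepFunctions {m : ℕ} {π : X → Fin (m + 1)} (hπ : Measurable π) (R : ℝ) :
    TotallyBounded ((fun a : Fin (m + 1) → ℝ => (memLp_one_comp_fin (μ := μ) hπ a).toLp) ''
      Set.pi Set.univ fun _ => Set.Icc (-R) R) := by
  refine (IsCompact.image (isCompact_univ_pi fun _ => isCompact_Icc) ?_).totallyBounded
  refine LipschitzWith.continuous (K := (μ Set.univ).toNNReal) fun a b => ?_
  rw [Lp.edist_toLp_toLp, eLpNorm_one_eq_lintegral_enorm,
    ENNReal.coe_toNNReal (measure_ne_top μ _), mul_comm, ← lintegral_const]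
  refine lintegral_mono fun x => ?_
  rw [Pi.sub_apply, ← edist_eq_enorm_sub]
  exact edist_le_pi_edist a b (π x)

lemma memLp_one_arctan {u : X → ℝ} (hu : AEMeasurable u μ) :
    MemLp (fun x => Real.arctan (u x)) 1 μ :=
  MemLp.of_bound (Real.measurable_arctan.comp_aemeasurable hu).aestronglyMeasurable 2
    (Eventually.of_forall fun x => by
      rw [Real.norm_eq_abs, abs_le]
      have h1 := Real.neg_pi_div_two_lt_arctan (u x)
      have h2 := Real.arctan_lt_pi_div_two (u x)
      have h3 := Real.pi_lt_four
      constructor <;> linarith)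

lemma abs_arctan_sub_le (a b : ℝ) : |Real.arctan a - Real.arctan b| ≤ |a - b| := by
  have h : LipschitzWith 1 Real.arctan := by
    refine lipschitzWith_of_nnnorm_deriv_le Real.differentiable_arctan fun x => ?_
    rw [← NNReal.coe_le_coe]
    simp only [Real.deriv_arctan, coe_nnnorm, Real.norm_eq_abs, NNReal.coe_one]
    rw [abs_of_nonneg (by positivity)]
    exact (div_le_one (by positivity)).2 (by nlinarith [sq_nonneg x])
  simpa [Real.dist_eq] using h.dist_le_mul a b

end Compactness

/-! ### Extraction of an a.e. convergent subsequence. -/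

section Subsequence

variable {X : Type*} [MetricSpace X] [MeasurableSpace X] [BorelSpace X] {μ : Measure X}
  [IsFiniteMeasure μ]

/-- Exponents below 1 are allowed, so `u n` itself need not lie in `L¹`; `arctan` is bounded and
1-Lipschitz, which cures this. Off a set whose measure is small uniformly in `n`, `max g |u| ≤ M`,
and there `u n` oscillates by at most `2 * M * r ^ s₀` on each cell of diameter below `r`. -/
lemma totallyBounded_arctan (hX : TotallyBounded (Set.univ : Set X)) {P S : X → ℝ} {p₀ s₀ : ℝ}
    (hPm : Measurable P) (hp₀ : 0 < p₀) (hP : ∀ x, p₀ ≤ P x) (hs₀ : 0 < s₀) (hS : ∀ x, s₀ ≤ S x)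
    {u : ℕ → X → ℝ} {g : ℕ → X → ℝ≥0∞} {N : ℕ → Set X} (hu : ∀ n, AEMeasurable (u n) μ)
    (hg : ∀ n, AEMeasurable (g n) μ) (hN : ∀ n, μ (N n) = 0)
    (hgrad : ∀ n, GradientOff (N n) S (u n) (g n))
    (hgP : ∀ n, ∫⁻ x, g n x ^ P x ∂μ ≤ 1) (huP : ∀ n, ∫⁻ x, ‖u n x‖ₑ ^ P x ∂μ ≤ 1) :
    TotallyBounded (Set.range fun n => (memLp_one_arctan (hu n)).toLp) := by
  refine totallyBounded_of_forall_approx fun ε hε => ?_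
  -- The factor 4 bounds the difference of two functions of modulus at most 2 on the bad set, whose
  -- measure is at most `2 * M ^ (-p₀)`.
  obtain ⟨M, hM1, hM⟩ : ∃ M : ℝ, 1 ≤ M ∧ 4 * (2 * M ^ (-p₀)) < ε / 2 := by
    have h1 : Tendsto (fun M : ℝ => 4 * (2 * M ^ (-p₀))) atTop (𝓝 (4 * (2 * 0))) :=
      ((tendsto_rpow_neg_atTop hp₀).const_mul 2).const_mul 4
    rw [mul_zero, mul_zero] at h1
    obtain ⟨M, h⟩ := ((h1.eventually_lt_const (half_pos hε)).and (eventually_ge_atTop 1)).exists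
    exact ⟨M, h.2, h.1⟩
  set m := (μ Set.univ).toReal with hm
  obtain ⟨r, hr0, hr1, hr⟩ : ∃ r : ℝ, 0 < r ∧ r ≤ 1 ∧ 2 * M * r ^ s₀ * m < ε / 2 := by
    have h1 : Tendsto (fun r : ℝ => 2 * M * r ^ s₀ * m) (𝓝[>] 0) (𝓝 (2 * M * 0 ^ s₀ * m)) :=
      ((((Real.continuousAt_rpow_const 0 s₀ (Or.inr hs₀.le)).tendsto).const_mul
        (2 * M)).mul_const m).mono_left nhdsWithin_le_nhds
    rw [Real.zero_rpow hs₀.ne', mul_zero, zero_mul] at h1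
    obtain ⟨r, h⟩ := ((h1.eventually_lt_const (half_pos hε)).and
      (Ioc_mem_nhdsGT (zero_lt_one))).exists
    exact ⟨r, h.2.1, h.2.2, h.1⟩
  obtain ⟨k, π, hπ, hdist⟩ := exists_measurable_partition hX hr0
  refine ⟨_, totallyBounded_stepFunctions (μ := μ) hπ 2, ?_⟩
  rintro _ ⟨n, rfl⟩
  classical
  let good : X → Prop := fun x => x ∉ N n ∧ max (g n x) ‖u n x‖ₑ ≤ ENNReal.ofReal M
  -- The value at some good point of the cell. A cell without good points lies in the bad set, so
  -- the default 0 is harmless.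
  let a : Fin (k + 1) → ℝ := fun i =>
    if h : ∃ x, π x = i ∧ good x then Real.arctan (u n h.choose) else 0
  have harc : ∀ t : ℝ, |Real.arctan t| ≤ 2 := by
    intro t
    rw [abs_le]
    have h1 := Real.neg_pi_div_two_lt_arctan t
    have h2 := Real.arctan_lt_pi_div_two t
    have h3 := Real.pi_lt_four
    constructor <;> linarith
  have ha : ∀ i, |a i| ≤ 2 := by
    intro i
    by_cases h : ∃ x, π x = i ∧ good x
    · simp only [a, dif_pos h]
      exact harc _
    · simp [a, dif_neg h]
  refine ⟨_, ⟨a, fun i _ => abs_le.1 (ha i), rfl⟩, ?_⟩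
  set bad : Set X := {y | y ∈ Set.univ ∧ ENNReal.ofReal M < max (g n y) ‖u n y‖ₑ} ∪ N n with hbad
  have hμbad : μ bad ≤ ENNReal.ofReal (2 * M ^ (-p₀)) :=
    measure_tail_le hPm (hg n) (hu n).enorm (hN n) (hgP n) (huP n) hp₀ (fun y _ => hP y) hM1
  -- The bad set contains the arbitrary null set `N n`, so it is replaced by its measurable hull
  -- before integrating.
  have hpt : ∀ x, ‖Real.arctan (u n x) - a (π x)‖ₑ ≤
      ENNReal.ofReal (2 * M * r ^ s₀) + (toMeasurable μ bad).indicator (fun _ => 4) x := by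
    intro x
    by_cases hx : x ∈ bad
    · refine le_add_left ?_
      rw [Set.indicator_of_mem (subset_toMeasurable _ _ hx), Real.enorm_eq_ofReal_abs]
      refine ENNReal.ofReal_le_of_le_toReal ?_
      have h1 := abs_sub (Real.arctan (u n x)) (a (π x))
      have h2 := ha (π x)
      have h3 := harc (u n x)
      simp only [ENNReal.toReal_ofNat]
      linarith
    · refine le_add_right ?_
      have hgood : good x := by
        simp only [hbad, Set.mem_univ, true_and, Set.mem_union, Set.mem_ofPred_eq, not_or,
          not_lt] at hx
        exact ⟨hx.2, hx.1⟩
      have hex : ∃ y, π y = π x ∧ good y := ⟨x, rfl, hgood⟩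
      have hax : a (π x) = Real.arctan (u n hex.choose) := by simp only [a, dif_pos hex]
      obtain ⟨hy1, hy2⟩ := hex.choose_spec
      set y := hex.choose
      have hxy : dist x y < r := hdist x y hy1.symm
      rw [hax, Real.enorm_eq_ofReal_abs]
      refine ENNReal.ofReal_le_ofReal ((abs_arctan_sub_le _ _).trans ?_)
      refine ((hgrad n).abs_sub_le hgood.1 hy2.1 hs₀ (hS x) (hS y) (by linarith) (by linarith)
        ((le_max_left _ _).trans hgood.2) ((le_max_left _ _).trans hy2.2)).trans ?_
      gcongr
  rw [Lp.dist_def, eLpNorm_congr_ae ((memLp_one_arctan (hu n)).coeFn_toLp.sub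
    (memLp_one_comp_fin hπ a).coeFn_toLp), eLpNorm_one_eq_lintegral_enorm]
  have hint : ∫⁻ x, ‖Real.arctan (u n x) - a (π x)‖ₑ ∂μ ≤
      ENNReal.ofReal (2 * M * r ^ s₀ * m + 4 * (2 * M ^ (-p₀))) := by
    refine (lintegral_mono hpt).trans ?_
    rw [lintegral_add_left measurable_const, lintegral_const,
      lintegral_indicator_const (measurableSet_toMeasurable _ _), measure_toMeasurable,
      ENNReal.ofReal_add (by positivity) (by positivity), ENNReal.ofReal_mul (p := 2 * M * r ^ s₀) (by positivity),
      ENNReal.ofReal_mul (by positivity) (p := 4), hm, ENNReal.ofReal_toReal (measure_ne_top μ _)]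
    gcongr
    simp
  refine (ENNReal.toReal_mono ENNReal.ofReal_ne_top hint).trans_lt ?_
  rw [ENNReal.toReal_ofReal (by positivity)]
  linarith

/-- Bounded sequences have almost everywhere convergent subsequences. -/
lemma exists_subseq_tendsto_ae (hX : TotallyBounded (Set.univ : Set X)) {P S : X → ℝ} {p₀ s₀ : ℝ}
    (hPm : Measurable P) (hp₀ : 0 < p₀) (hP : ∀ x, p₀ ≤ P x) (hs₀ : 0 < s₀) (hS : ∀ x, s₀ ≤ S x)
    {u : ℕ → X → ℝ} {g : ℕ → X → ℝ≥0∞} {N : ℕ → Set X} (hu : ∀ n, Measurable (u n))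
    (hg : ∀ n, AEMeasurable (g n) μ) (hN : ∀ n, μ (N n) = 0)
    (hgrad : ∀ n, GradientOff (N n) S (u n) (g n))
    (hgP : ∀ n, ∫⁻ x, g n x ^ P x ∂μ ≤ 1) (huP : ∀ n, ∫⁻ x, ‖u n x‖ₑ ^ P x ∂μ ≤ 1) :
    ∃ (k : ℕ → ℕ) (v : X → ℝ), StrictMono k ∧ AEMeasurable v μ ∧
      ∀ᵐ x ∂μ, Tendsto (fun n => u (k n) x) atTop (𝓝 (v x)) := by
  have hu' : ∀ n, AEMeasurable (u n) μ := fun n => (hu n).aemeasurable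
  have htb := totallyBounded_arctan hX hPm hp₀ hP hs₀ hS hu' hg hN hgrad hgP huP
  have hcomp : IsCompact (closure (Set.range fun n => (memLp_one_arctan (hu' n)).toLp)) :=
    TotallyBounded.isCompact_of_isClosed htb.closure isClosed_closure
  obtain ⟨f, -, φ, hφ, hlim⟩ := hcomp.tendsto_subseq
    (x := fun n => (memLp_one_arctan (hu' n)).toLp) (fun n => subset_closure ⟨n, rfl⟩)
  obtain ⟨ψ, hψ, hae⟩ := (tendstoInMeasure_of_tendsto_Lp hlim).exists_seq_tendsto_ae
  have hcoe : ∀ᵐ x ∂μ, ∀ n, MemLp.toLp _ (memLp_one_arctan (hu' n)) x = Real.arctan (u n x) :=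
    ae_all_iff.2 fun n => (memLp_one_arctan (hu' n)).coeFn_toLp
  -- By Fatou, `|u|` stays bounded along a further subsequence at a.e. point. Hence the limit of
  -- `arctan u` avoids `±π/2`, and `tan` can be applied to it.
  have hfatou : ∀ᵐ x ∂μ, liminf (fun n => ‖u (φ (ψ n)) x‖ₑ ^ P x) atTop < ∞ := by
    refine ae_lt_top (.liminf fun n => (hu _).enorm.pow hPm) ?_
    refine ne_top_of_le_ne_top ENNReal.one_ne_top
      ((lintegral_liminf_le fun n => (hu _).enorm.pow hPm).trans ?_)
    exact liminf_le_of_le (by isBoundedDefault)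
      fun b hb => hb.exists.elim fun n hn => hn.trans (huP _)
  have hconv : ∀ᵐ x ∂μ, Tendsto (fun n => u (φ (ψ n)) x) atTop (𝓝 (Real.tan (f x))) := by
    filter_upwards [hae, hcoe, hfatou] with x hx hcx hfx
    simp only [Function.comp, hcx] at hx
    obtain ⟨c, hc1, hc2⟩ := exists_between hfx
    have hPx : 0 < P x := hp₀.trans_le (hP x)
    have hfreq : ∃ᶠ n in atTop, ‖u (φ (ψ n)) x‖ₑ ^ P x < c :=
      frequently_lt_of_liminf_lt (by isBoundedDefault) hc1
    have hcr : c ^ (P x)⁻¹ ≠ ∞ := ENNReal.rpow_ne_top_of_nonneg (by positivity) hc2.ne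
    set B := (c ^ (P x)⁻¹).toReal with hB
    have hfreq' : ∃ᶠ n in atTop,
        Real.arctan (u (φ (ψ n)) x) ∈ Set.Icc (-Real.arctan B) (Real.arctan B) := by
      refine hfreq.mono fun n hn => ?_
      have h1 : ‖u (φ (ψ n)) x‖ₑ ≤ ENNReal.ofReal B := by
        rw [hB, ENNReal.ofReal_toReal hcr, ENNReal.le_rpow_inv_iff hPx]
        exact hn.le
      have h2 := abs_le.1 (abs_le_of_enorm_le ENNReal.toReal_nonneg h1)
      rw [← Real.arctan_neg]
      exact ⟨Real.arctan_strictMono.monotone h2.1, Real.arctan_strictMono.monotone h2.2⟩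
    have hmem := isClosed_Icc.mem_of_frequently_of_tendsto hfreq' hx
    have hlt := Real.arctan_lt_pi_div_two B
    have hcos : Real.cos (f x) ≠ 0 :=
      (Real.cos_pos_of_mem_Ioo ⟨by linarith [hmem.1], by linarith [hmem.2]⟩).ne'
    have := (Real.continuousAt_tan.2 hcos).tendsto.comp hx
    simpa [Function.comp_def, Real.tan_arctan] using this
  exact ⟨φ ∘ ψ, fun x => Real.tan (f x), hφ.comp hψ,
    aemeasurable_of_tendsto_metrizable_ae atTop (fun n => hu' (φ (ψ n))) hconv, hconv⟩

end Subsequence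

/-! ### Modular convergence from a.e. convergence and higher integrability. -/

section Vitali

variable {X : Type*} [MeasurableSpace X] {μ : Measure X}

/-- Splits at height `M`: dominated convergence handles the truncated part, and the higher exponent
makes the rest small uniformly as `M` grows. -/
lemma rpow_le_min_rpow_add (w : ℝ≥0∞) {q η M : ℝ} (hq : 0 ≤ q) (hη : 0 < η) (hM : 0 < M) :
    w ^ q ≤ min w (ENNReal.ofReal M) ^ q + ENNReal.ofReal (M ^ (-η)) * w ^ (q + η) := by
  rcases le_total w (ENNReal.ofReal M) with h | h
  · rw [min_eq_left h]
    exact le_self_add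
  · refine le_add_left ?_
    have h1 : ENNReal.ofReal (M ^ (-η)) * ENNReal.ofReal (M ^ η) = 1 := by
      rw [← ENNReal.ofReal_mul (by positivity), ← Real.rpow_add hM]
      simp
    calc w ^ q = ENNReal.ofReal (M ^ (-η)) * (w ^ q * ENNReal.ofReal (M ^ η)) := by
          rw [mul_left_comm, h1, mul_one]
      _ ≤ ENNReal.ofReal (M ^ (-η)) * (w ^ q * w ^ η) := by
          gcongr
          rw [← ENNReal.ofReal_rpow_of_pos hM]
          gcongr
      _ = ENNReal.ofReal (M ^ (-η)) * w ^ (q + η) := by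
          rw [ENNReal.rpow_add_of_nonneg _ _ hq hη.le]

/-- Vitali convergence for modulars with a variable exponent. -/
lemma tendsto_lintegral_rpow_zero [IsFiniteMeasure μ] {q : X → ℝ} {q₀ q₁ η : ℝ} {D : ℝ≥0∞}
    {w : ℕ → X → ℝ≥0∞} (hqm : Measurable q) (hq₀ : 0 < q₀)
    (hq : ∀ᵐ x ∂μ, q₀ ≤ q x ∧ q x ≤ q₁) (hη : 0 < η) (hD : D ≠ ∞)
    (hw : ∀ n, AEMeasurable (w n) μ) (hwD : ∀ n, ∫⁻ x, w n x ^ (q x + η) ∂μ ≤ D)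
    (hlim : ∀ᵐ x ∂μ, Tendsto (fun n => w n x) atTop (𝓝 0)) :
    Tendsto (fun n => ∫⁻ x, w n x ^ q x ∂μ) atTop (𝓝 0) := by
  rw [ENNReal.tendsto_nhds_zero]
  intro ε hε
  obtain ⟨M, hM1, hM⟩ : ∃ M : ℝ, 1 ≤ M ∧ ENNReal.ofReal (M ^ (-η)) * D ≤ ε / 2 := by
    have h1 : Tendsto (fun M : ℝ => ENNReal.ofReal (M ^ (-η)) * D) atTop
        (𝓝 (ENNReal.ofReal 0 * D)) :=
      ENNReal.Tendsto.mul_const (ENNReal.tendsto_ofReal (tendsto_rpow_neg_atTop hη)) (Or.inr hD)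
    rw [ENNReal.ofReal_zero, zero_mul, ENNReal.tendsto_nhds_zero] at h1
    obtain ⟨M, h⟩ := ((h1 _ (ENNReal.half_pos hε.ne')).and (eventually_ge_atTop 1)).exists
    exact ⟨M, h.2, h.1⟩
  have hM0 : 0 < M := by linarith
  have hmin : ∀ n, AEMeasurable (fun x => min (w n x) (ENNReal.ofReal M) ^ q x) μ := fun n =>
    ((hw n).min aemeasurable_const).pow hqm.aemeasurable
  have hdct : Tendsto (fun n => ∫⁻ x, min (w n x) (ENNReal.ofReal M) ^ q x ∂μ) atTop
      (𝓝 (∫⁻ _, 0 ∂μ)) := by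
    refine tendsto_lintegral_of_dominated_convergence' (fun _ => ENNReal.ofReal (M ^ q₁)) hmin
      (fun n => ?_) ?_ ?_
    · filter_upwards [hq] with x hx
      have hqx : 0 ≤ q x := hq₀.le.trans hx.1
      calc min (w n x) (ENNReal.ofReal M) ^ q x ≤ ENNReal.ofReal M ^ q x :=
            ENNReal.rpow_le_rpow (min_le_right _ _) hqx
        _ = ENNReal.ofReal (M ^ q x) := ENNReal.ofReal_rpow_of_pos hM0
        _ ≤ ENNReal.ofReal (M ^ q₁) :=
            ENNReal.ofReal_le_ofReal (Real.rpow_le_rpow_of_exponent_le hM1 hx.2)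
    · rw [lintegral_const]
      exact ENNReal.mul_ne_top ENNReal.ofReal_ne_top (measure_ne_top μ _)
    · filter_upwards [hq, hlim] with x hx hlx
      have hqx : 0 < q x := hq₀.trans_le hx.1
      have h1 : Tendsto (fun n => min (w n x) (ENNReal.ofReal M)) atTop (𝓝 0) :=
        tendsto_of_tendsto_of_tendsto_of_le_of_le tendsto_const_nhds hlx (fun _ => zero_le)
          fun _ => min_le_left _ _
      have h2 := (ENNReal.continuous_rpow_const (y := q x)).tendsto 0 |>.comp h1
      rwa [ENNReal.zero_rpow_of_pos hqx] at h2
  rw [lintegral_zero, ENNReal.tendsto_nhds_zero] at hdct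
  filter_upwards [hdct _ (ENNReal.half_pos hε.ne')] with n hn
  calc ∫⁻ x, w n x ^ q x ∂μ
      ≤ ∫⁻ x, min (w n x) (ENNReal.ofReal M) ^ q x +
          ENNReal.ofReal (M ^ (-η)) * w n x ^ (q x + η) ∂μ := by
        refine lintegral_mono_ae ?_
        filter_upwards [hq] with x hx
        exact rpow_le_min_rpow_add _ (hq₀.le.trans hx.1) hη hM0
    _ = ∫⁻ x, min (w n x) (ENNReal.ofReal M) ^ q x ∂μ +
          ENNReal.ofReal (M ^ (-η)) * ∫⁻ x, w n x ^ (q x + η) ∂μ := by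
        rw [lintegral_add_left' (hmin n), lintegral_const_mul' _ _ ENNReal.ofReal_ne_top]
    _ ≤ ε / 2 + ε / 2 := by
        gcongr
        exact (mul_le_mul_right (hwD n) _).trans hM
    _ = ε := ENNReal.add_halves ε

lemma lintegral_rpow_le_add [IsFiniteMeasure μ] {q : X → ℝ} {η : ℝ} {f : X → ℝ≥0∞}
    (hq : ∀ᵐ x ∂μ, 0 ≤ q x) (hη : 0 ≤ η) :
    ∫⁻ x, f x ^ q x ∂μ ≤ ∫⁻ x, f x ^ (q x + η) ∂μ + μ Set.univ := by
  rw [← setLIntegral_one Set.univ, Measure.restrict_univ, ← lintegral_add_right _ measurable_const]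
  refine lintegral_mono_ae ?_
  filter_upwards [hq] with x hx
  rcases le_total (f x) 1 with h | h
  · exact le_add_left (ENNReal.rpow_le_one h hx)
  · exact le_add_right (ENNReal.rpow_le_rpow_of_exponent_le h (by linarith))

lemma lintegral_const_mul_add_rpow_le {t : X → ℝ} {t₁ : ℝ} {f g : X → ℝ≥0∞} {c : ℝ≥0∞}
    (hf : AEMeasurable f μ) (htm : Measurable t) (ht : ∀ᵐ x ∂μ, 0 ≤ t x ∧ t x ≤ t₁)
    (hc : c ≠ ∞) :
    ∫⁻ x, (c * (f x + g x)) ^ t x ∂μ ≤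
      max 1 (2 * c) ^ t₁ * (∫⁻ x, f x ^ t x ∂μ + ∫⁻ x, g x ^ t x ∂μ) := by
  rw [← lintegral_add_left' (hf.pow htm.aemeasurable)]
  have h1 : (1 : ℝ≥0∞) ≤ max 1 (2 * c) := le_max_left _ _
  have htop : max 1 (2 * c) ^ t₁ ≠ ∞ :=
    ENNReal.rpow_ne_top_of_ne_zero (zero_lt_one.trans_le h1).ne'
      (max_ne_top ENNReal.one_ne_top (ENNReal.mul_ne_top (by simp) hc))
  rw [← lintegral_const_mul' _ _ htop]
  refine lintegral_mono_ae ?_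
  filter_upwards [ht] with x hx
  calc (c * (f x + g x)) ^ t x ≤ (max 1 (2 * c) * max (f x) (g x)) ^ t x := by
        refine ENNReal.rpow_le_rpow ?_ hx.1
        calc c * (f x + g x) ≤ c * (max (f x) (g x) + max (f x) (g x)) := by
              gcongr
              · exact le_max_left _ _
              · exact le_max_right _ _
          _ = 2 * c * max (f x) (g x) := by ring
          _ ≤ _ := by
              gcongr
              exact le_max_right _ _
    _ = max 1 (2 * c) ^ t x * max (f x) (g x) ^ t x := ENNReal.mul_rpow_of_nonneg _ _ hx.1
    _ ≤ max 1 (2 * c) ^ t₁ * (f x ^ t x + g x ^ t x) := by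
        gcongr
        · exact hx.2
        · exact max_rpow_le_add _ _ _

end Vitali

/-! ### Passing between modulars and quasi-norms. -/

section Norms

variable {X : Type*} [MeasurableSpace X] {μ : Measure X}

lemma phi_mono (p : ℝ≥0∞) {a b : ℝ≥0∞} (h : a ≤ b) : phi p a ≤ phi p b := by
  unfold phi
  split_ifs with h1 h2 h3 h3
  · exact le_rfl
  · exact zero_le
  · exact absurd (h.trans h3) h2
  · exact le_rfl
  · exact ENNReal.rpow_le_rpow h ENNReal.toReal_nonneg

lemma modular_eq {q : X → ℝ≥0∞} (hq : ∀ᵐ x ∂μ, q x ≠ ∞) (f : X → ℝ≥0∞) :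
    modular μ q f = ∫⁻ x, f x ^ (q x).toReal ∂μ := by
  refine lintegral_congr_ae ?_
  filter_upwards [hq] with x hx
  simp [phi, hx]

lemma luxNorm_le {q : X → ℝ≥0∞} {f : X → ℝ≥0∞} {t : ℝ≥0∞} (h0 : t ≠ 0) (h1 : t ≠ ∞)
    (h : modular μ q (fun x => f x / t) ≤ 1) : luxNorm μ q f ≤ t :=
  sInf_le ⟨pos_iff_ne_zero.2 h0, h1.lt_top, h⟩

lemma modular_div_le_one {q : X → ℝ≥0∞} {f : X → ℝ≥0∞} {t : ℝ≥0∞} (h : luxNorm μ q f < t) :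
    modular μ q (fun x => f x / t) ≤ 1 := by
  obtain ⟨a, ⟨-, -, ha⟩, hat⟩ := sInf_lt_iff.1 h
  exact (lintegral_mono fun x => phi_mono _ (ENNReal.div_le_div_left hat.le _)).trans ha

/-- For `C ≥ 1`, division by `C` shrinks the integrand by at least `C ^ q₀`. This converts a modular
bound into a norm bound. -/
lemma lintegral_div_rpow_le_one {q : X → ℝ} {q₀ C : ℝ} {f : X → ℝ≥0∞} (hq₀ : 0 < q₀)
    (hq : ∀ᵐ x ∂μ, q₀ ≤ q x) (hC : 1 ≤ C)
    (hf : ∫⁻ x, f x ^ q x ∂μ ≤ ENNReal.ofReal (C ^ q₀)) :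
    ∫⁻ x, (f x / ENNReal.ofReal C) ^ q x ∂μ ≤ 1 := by
  have hC0 : 0 < C := by linarith
  have hCq : ENNReal.ofReal (C ^ q₀) ≠ 0 := by
    have : 0 < C ^ q₀ := by positivity
    simpa using this
  calc ∫⁻ x, (f x / ENNReal.ofReal C) ^ q x ∂μ
      ≤ ∫⁻ x, (ENNReal.ofReal (C ^ q₀))⁻¹ * f x ^ q x ∂μ := by
        refine lintegral_mono_ae ?_
        filter_upwards [hq] with x hx
        rw [ENNReal.div_rpow_of_nonneg _ _ (hq₀.le.trans hx), div_eq_mul_inv, mul_comm,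
          ENNReal.ofReal_rpow_of_pos hC0]
        gcongr
    _ = (ENNReal.ofReal (C ^ q₀))⁻¹ * ∫⁻ x, f x ^ q x ∂μ :=
        lintegral_const_mul' _ _ (ENNReal.inv_ne_top.2 hCq)
    _ ≤ (ENNReal.ofReal (C ^ q₀))⁻¹ * ENNReal.ofReal (C ^ q₀) := by gcongr
    _ = 1 := ENNReal.inv_mul_cancel hCq ENNReal.ofReal_ne_top

lemma exists_one_le_rpow_ge {q₀ : ℝ} (hq₀ : 0 < q₀) {D : ℝ≥0∞} (hD : D ≠ ∞) :
    ∃ C : ℝ, 1 ≤ C ∧ D ≤ ENNReal.ofReal (C ^ q₀) := by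
  obtain ⟨C, h1, h2⟩ := ((tendsto_rpow_atTop hq₀).eventually_ge_atTop D.toReal).and
    (eventually_ge_atTop 1) |>.exists
  exact ⟨C, h2, ENNReal.le_ofReal_iff_toReal_le hD (by positivity) |>.2 h1⟩

lemma LvarNorm_lt_top {p : X → ℝ≥0∞} {p₀ : ℝ} (hp₀ : 0 < p₀)
    (hp : ∀ᵐ x ∂μ, p x ≠ ∞ ∧ p₀ ≤ (p x).toReal) {u : X →ₘ[μ] ℝ} (hu : u ∈ Lvar μ p) :
    LvarNorm μ p u < ∞ := by
  obtain ⟨t, ht0, ht, hmod⟩ := hu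
  have hfin : ∀ᵐ x ∂μ, p x ≠ ∞ := hp.mono fun x hx => hx.1
  rw [modular_eq hfin] at hmod
  obtain ⟨C, hC1, hC⟩ := exists_one_le_rpow_ge hp₀ hmod.ne
  have h1 := lintegral_div_rpow_le_one hp₀ (hp.mono fun x hx => hx.2) hC1 hC
  have hC0 : ENNReal.ofReal C ≠ 0 := by
    simp only [ne_eq, ENNReal.ofReal_eq_zero, not_le]
    linarith
  have hlt : ENNReal.ofReal C / t < ∞ := ENNReal.div_lt_top ENNReal.ofReal_ne_top ht0.ne'
  refine lt_of_le_of_lt (luxNorm_le (t := ENNReal.ofReal C / t)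
    (ENNReal.div_ne_zero.2 ⟨hC0, ht.ne⟩) hlt.ne ?_) hlt
  rw [modular_eq hfin]
  refine le_of_eq_of_le (lintegral_congr fun x => ?_) h1
  congr 1
  rw [div_eq_mul_inv, ENNReal.inv_div (Or.inl ht.ne) (Or.inl ht0.ne'), div_eq_mul_inv,
    div_eq_mul_inv]
  ring

end Norms

/-! ### Exponent arithmetic, uniform higher integrability and normalisation. -/

section Main

lemma toReal_sub_of_ofReal_le {a b : ℝ≥0∞} {δ : ℝ} (hδ : 0 < δ) (ha : a ≠ ∞)
    (h : ENNReal.ofReal δ ≤ a - b) : b ≤ a ∧ δ ≤ a.toReal - b.toReal := by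
  have hlt : 0 < a - b := (ENNReal.ofReal_pos.2 hδ).trans_le h
  have hba : b ≤ a := (tsub_pos_iff_lt.1 hlt).le
  refine ⟨hba, ?_⟩
  rw [← ENNReal.toReal_sub_of_le hba ha]
  exact (ENNReal.ofReal_le_iff_le_toReal (ne_top_of_le_ne_top ha tsub_le_self)).1 h

/-- The gap `q ≪ γ` absorbs a small loss in `s p` and a small gain in `q`. -/
lemma exponent_gap {Q P S q δ₁ δ₂ Q₁ p₁ τ : ℝ} (hQ : 0 < Q) (hP : 0 < P) (hS : 0 < S)
    (hq : 0 < q) (hδ₁ : 0 < δ₁) (hδ₂ : 0 < δ₂) (hQ₁ : Q ≤ Q₁) (hp₁ : P ≤ p₁)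
    (h₁ : δ₁ ≤ Q - S * P) (h₂ : δ₂ ≤ Q * P / (Q - S * P) - q) (hτ1 : τ < 1)
    (hτ : 1 - τ ^ 2 ≤ δ₂ / 2 * (δ₁ / Q₁) / (Q₁ * p₁ / δ₁)) (hτ0 : 0 < τ) :
    δ₁ / Q₁ ≤ 1 - τ * P / Q * (τ * S) ∧ (1 - τ * P / Q * (τ * S)) * (q + δ₂ / 2) ≤ P ∧
      q + δ₂ / 2 ≤ Q₁ * p₁ / δ₁ := by
  have hden : 0 < Q - S * P := by linarith
  have hQ₁0 : 0 < Q₁ := by linarith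
  have hp₁0 : 0 < p₁ := by linarith
  set Γ := Q₁ * p₁ / δ₁ with hΓ
  have hΓ0 : 0 < Γ := by positivity
  set θ₀ := δ₁ / Q₁ with hθ₀
  have hγ : Q * P / (Q - S * P) ≤ Γ := by
    rw [hΓ]
    gcongr
  set σ := 1 - S * P / Q with hσ
  have hσθ : θ₀ ≤ σ := by
    have : σ = (Q - S * P) / Q := by rw [hσ]; field_simp
    rw [this, hθ₀]
    gcongr
  -- The identity `γσ = P`, with `σ = 1 - SP/Q`: lowering the power from `γ` to `q + δ₂/2` saves at
  -- least `σδ₂/2 ≥ θ₀δ₂/2`. The loss from `τ`, estimated in `e1`, is no larger.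
  have hγσ : Q * P / (Q - S * P) * σ = P := by
    rw [hσ]
    field_simp
    rw [mul_comm P S, div_self hden.ne']
  have hθ : 1 - τ * P / Q * (τ * S) = σ + (1 - τ ^ 2) * (S * P / Q) := by
    rw [hσ]
    ring
  have hτ2 : 0 ≤ 1 - τ ^ 2 := by nlinarith
  have hr0 : 0 < S * P / Q := by positivity
  have hr1 : S * P / Q ≤ 1 := by
    rw [div_le_one hQ]
    linarith
  have hθ0 : 0 < θ₀ := by positivity
  rw [hθ]
  rw [le_div_iff₀ hΓ0] at hτ
  have hqΓ : q + δ₂ / 2 ≤ Γ := by linarith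
  refine ⟨by nlinarith, ?_, hqΓ⟩
  have e1 : (1 - τ ^ 2) * (S * P / Q) * (q + δ₂ / 2) ≤ δ₂ / 2 * θ₀ := by
    calc (1 - τ ^ 2) * (S * P / Q) * (q + δ₂ / 2) ≤ (1 - τ ^ 2) * 1 * Γ := by gcongr
      _ ≤ δ₂ / 2 * θ₀ := by linarith
  have e2 : σ * (q + δ₂ / 2) ≤ P - δ₂ / 2 * σ := by
    have : σ * (q + δ₂ / 2) ≤ σ * (Q * P / (Q - S * P) - δ₂ / 2) := by
      refine mul_le_mul_of_nonneg_left ?_ (by linarith)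
      linarith
    linarith
  nlinarith

variable {X : Type*} [MetricSpace X] [MeasurableSpace X]

/-- Higher integrability of normalised functions, with uniform constants. -/
lemma exists_uniform_higher_integrability {μ : Measure X} [IsFiniteMeasure μ]
    (hμ : BallsPosFinite μ) {Q p s q : X → ℝ≥0∞}
    (hQ : IsLogBddExponent μ Q) (hμQ : LowerAhlfors μ Q) (hp : IsLogBddExponent μ p)
    (hs : IsLogBddExponent μ s) (hspQ : MuchLess μ (fun x => s x * p x) Q)
    (hq : IsBddExponent μ q) (hqγ : MuchLess μ q (fun x => Q x * p x / (Q x - s x * p x))) :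
    ∃ (η : ℝ) (D : ℝ≥0∞), 0 < η ∧ D ≠ ∞ ∧
      ∀ (u : X → ℝ) (g : X → ℝ≥0∞) (N : Set X), AEMeasurable u μ → AEMeasurable g μ → μ N = 0 →
        GradientOff N (fun x => (s x).toReal) u g →
        ∫⁻ x, g x ^ (p x).toReal ∂μ ≤ 1 → ∫⁻ x, ‖u x‖ₑ ^ (p x).toReal ∂μ ≤ 1 →
        ∫⁻ x, ‖u x‖ₑ ^ ((q x).toReal + η) ∂μ ≤ D := by
  obtain ⟨⟨p₀, p₁, hp₀, hp₀₁, hpb⟩, hpτ⟩ := hp.bounds hμ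
  obtain ⟨⟨s₀, s₁, hs₀, hs₀₁, hsb⟩, hsτ⟩ := hs.bounds hμ
  obtain ⟨⟨Q₀, Q₁, hQ₀, hQ₀₁, hQb⟩, -⟩ := hQ.bounds hμ
  obtain ⟨q₀, q₁, hq₀, -, hqb⟩ := hq.ae_bounds
  obtain ⟨δ₁, hδ₁, h₁⟩ := hspQ.exists_pos
  obtain ⟨δ₂, hδ₂, h₂⟩ := hqγ.exists_pos
  obtain ⟨b, hb, hball⟩ := hμQ
  have hQ₁ : 0 < Q₁ := hQ₀.trans_le hQ₀₁
  have hp₁ : 0 < p₁ := hp₀.trans_le hp₀₁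
  set κ := min 1 (δ₂ / 2 * (δ₁ / Q₁) / (Q₁ * p₁ / δ₁)) with hκ
  have hκ0 : 0 < κ := lt_min one_pos (by positivity)
  have hκ1 : κ ≤ 1 := min_le_left _ _
  -- Then `1 - τ ^ 2 = κ - κ ^ 2 / 4 ≤ κ`.
  set τ := 1 - κ / 2 with hτ
  have hτ0 : 0 < τ := by linarith
  have hτ1 : τ < 1 := by linarith
  have hτκ : 1 - τ ^ 2 ≤ δ₂ / 2 * (δ₁ / Q₁) / (Q₁ * p₁ / δ₁) := by
    refine le_trans ?_ (min_le_right 1 _)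
    rw [← hκ, hτ]
    nlinarith
  obtain ⟨r₁, hr₁, hpr⟩ := hpτ τ hτ0 hτ1
  obtain ⟨r₂, hr₂, hsr⟩ := hsτ τ hτ0 hτ1
  obtain ⟨C, hC, hmain⟩ := exists_enorm_le_mul_max_rpow (μ := μ) (Q := fun x => (Q x).toReal)
    (P := fun x => (p x).toReal) (S := fun x => (s x).toReal) (θ₀ := δ₁ / Q₁)
    hp.measurable.ennreal_toReal hp₀
    (fun x => (hpb x).2.1) hs₀ (fun x => (hsb x).2) hQ₀ (fun x => (hQb x).2) hQ₀₁ hb hball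
    hτ0 hτ1 (lt_min hr₁ hr₂) (fun x y h => hpr x y (h.trans_le (min_le_left _ _)))
    (fun x y h => hsr x y (h.trans_le (min_le_right _ _))) (by positivity)
  have hgap : ∀ᵐ x ∂μ, δ₁ / Q₁ ≤
      1 - τ * (p x).toReal / (Q x).toReal * (τ * (s x).toReal) ∧
      0 ≤ (q x).toReal + δ₂ / 2 ∧ (q x).toReal + δ₂ / 2 ≤ Q₁ * p₁ / δ₁ ∧
      (1 - τ * (p x).toReal / (Q x).toReal * (τ * (s x).toReal)) * ((q x).toReal + δ₂ / 2) ≤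
        (p x).toReal := by
    filter_upwards [h₁, h₂, hqb] with x hx₁ hx₂ hqx
    obtain ⟨hle, h1⟩ := toReal_sub_of_ofReal_le hδ₁ (hQb x).1 hx₁
    have hne : Q x - s x * p x ≠ 0 := ((ENNReal.ofReal_pos.2 hδ₁).trans_le hx₁).ne'
    obtain ⟨-, h2⟩ := toReal_sub_of_ofReal_le hδ₂
      (ENNReal.div_ne_top (ENNReal.mul_ne_top (hQb x).1 (hpb x).1) hne) hx₂
    rw [ENNReal.toReal_div, ENNReal.toReal_sub_of_le hle (hQb x).1, ENNReal.toReal_mul,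
      ENNReal.toReal_mul] at h2
    rw [ENNReal.toReal_mul] at h1
    have hq : 0 < (q x).toReal := hq₀.trans_le hqx.2.1
    obtain ⟨e1, e2, e3⟩ := exponent_gap (hQ₀.trans_le (hQb x).2.1) (hp₀.trans_le (hpb x).2.1)
      (hs₀.trans_le (hsb x).2.1) hq hδ₁ hδ₂ (hQb x).2.2 (hpb x).2.2 h1 h2 hτ1 hτκ hτ0
    exact ⟨e1, by positivity, e3, e2⟩
  refine ⟨δ₂ / 2, ENNReal.ofReal (C ^ (Q₁ * p₁ / δ₁)) * (μ Set.univ + 2), by positivity,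
    ENNReal.mul_ne_top ENNReal.ofReal_ne_top (by simp), ?_⟩
  intro u g N hu hg hN hgrad hgP huP
  refine lintegral_rpow_le_of_pointwise hC hp.measurable.ennreal_toReal hg hu hgP huP
    (hgap.mono fun x hx => hx.2) ?_
  filter_upwards [hgap, measure_eq_zero_iff_ae_notMem.1 hN] with x hx hxN
  exact hmain u g N hu hg hN hgrad hgP huP x hxN hx.1

/-- Dividing by a number larger than the norm yields a normalised function and gradient. -/
lemma exists_normalized {μ : Measure X} {s p : X → ℝ≥0∞} (hp : ∀ᵐ x ∂μ, p x ≠ ∞)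
    {u : X →ₘ[μ] ℝ} {L : ℝ} (hL : 0 < L) (h : MNorm μ s p u < ENNReal.ofReal L) :
    ∃ (g : X → ℝ≥0∞) (N : Set X), Measurable g ∧ μ N = 0 ∧
      GradientOff N (fun x => (s x).toReal) (fun x => L⁻¹ * u x) g ∧
      ∫⁻ x, g x ^ (p x).toReal ∂μ ≤ 1 ∧ ∫⁻ x, ‖L⁻¹ * u x‖ₑ ^ (p x).toReal ∂μ ≤ 1 := by
  have hL' : ‖L⁻¹‖ₑ = (ENNReal.ofReal L)⁻¹ := by
    rw [Real.enorm_eq_ofReal_abs, abs_of_pos (inv_pos.2 hL), ENNReal.ofReal_inv_of_pos hL]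
  have h1 : luxNorm μ p (fun x => ‖u x‖ₑ) < ENNReal.ofReal L := lt_of_le_of_lt le_self_add h
  have h2 : homNorm μ s p u < ENNReal.ofReal L := lt_of_le_of_lt le_add_self h
  obtain ⟨_, ⟨g, hg, ⟨N, hN, hgrad⟩, rfl⟩, hgL⟩ := sInf_lt_iff.1 h2
  have e1 := modular_div_le_one h1
  have e2 := modular_div_le_one hgL
  rw [modular_eq hp] at e1 e2
  refine ⟨fun x => g x / ENNReal.ofReal L, N, hg.div_const _, hN, fun x hx y hy => ?_, e2, ?_⟩
  · rw [← mul_sub, enorm_mul, hL']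
    calc (ENNReal.ofReal L)⁻¹ * ‖u x - u y‖ₑ ≤ (ENNReal.ofReal L)⁻¹ *
          (edist x y ^ (s x).toReal * g x + edist x y ^ (s y).toReal * g y) := by
            gcongr
            exact hgrad x hx y hy
      _ = _ := by
          simp only [div_eq_mul_inv]
          ring
  · refine le_of_eq_of_le (lintegral_congr fun x => ?_) e1
    rw [enorm_mul, hL', mul_comm, div_eq_mul_inv]

end Main

end VarExp

/-! ### The compact embedding. -/

theorem mainTheorem8 {X : Type*} [MetricSpace X] [MeasurableSpace X] [BorelSpace X]
    (μ : Measure X) (hμ : VarExp.BallsPosFinite μ)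
    (hX : TotallyBounded (Set.univ : Set X))
    (Q p s : X → ℝ≥0∞)
    (hQ : VarExp.IsLogBddExponent μ Q) (hμQ : VarExp.LowerAhlfors μ Q)
    (hp : VarExp.IsLogBddExponent μ p) (hs : VarExp.IsLogBddExponent μ s)
    (hspQ : VarExp.MuchLess μ (fun x => s x * p x) Q)
    (q : X → ℝ≥0∞) (hq : VarExp.IsBddExponent μ q)
    (hpq : ∀ᵐ x ∂μ, p x ≤ q x)
    (hqγ : VarExp.MuchLess μ q (fun x => Q x * p x / (Q x - s x * p x))) :
    VarExp.CompactEmbedding (VarExp.Mspace μ s p) (VarExp.MNorm μ s p)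
      (VarExp.Lvar μ q) (VarExp.LvarNorm μ q) := by
  have := hμ.isFiniteMeasure hX
  obtain ⟨η, D, hη, hD, hint⟩ :=
    VarExp.exists_uniform_higher_integrability hμ hQ hμQ hp hs hspQ hq hqγ
  obtain ⟨⟨p₀, p₁, hp₀, -, hpb⟩, -⟩ := hp.bounds hμ
  obtain ⟨⟨s₀, s₁, hs₀, -, hsb⟩, -⟩ := hs.bounds hμ
  obtain ⟨q₀, q₁, hq₀, -, hqb⟩ := hq.ae_bounds
  have hpm : Measurable fun x => (p x).toReal := hp.measurable.ennreal_toReal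
  have hqm : Measurable fun x => (q x).toReal := hq.measurable.ennreal_toReal
  have hpfin : ∀ᵐ x ∂μ, p x ≠ ∞ := Eventually.of_forall fun x => (hpb x).1
  have hqfin : ∀ᵐ x ∂μ, q x ≠ ∞ := hqb.mono fun x hx => hx.1
  have hq0 : ∀ᵐ x ∂μ, 0 ≤ (q x).toReal := Eventually.of_forall fun x => ENNReal.toReal_nonneg
  -- From `t^q ≤ t^(q+η) + 1`, integrated over a space of finite measure.
  set D' := D + μ Set.univ with hD'
  have hD'top : D' ≠ ∞ := ENNReal.add_ne_top.2 ⟨hD, measure_ne_top μ _⟩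
  have hnorm : ∀ (u : X →ₘ[μ] ℝ) (L : ℝ), 0 < L → VarExp.MNorm μ s p u < ENNReal.ofReal L →
      ∫⁻ x, ‖L⁻¹ * u x‖ₑ ^ (q x).toReal ∂μ ≤ D' := by
    intro u L hL hu
    obtain ⟨g, N, hg, hN, hgrad, hgP, huP⟩ := VarExp.exists_normalized hpfin hL hu
    have h1 := hint (fun x => L⁻¹ * u x) g N (u.measurable.const_mul _).aemeasurable
      hg.aemeasurable hN hgrad hgP huP
    exact (VarExp.lintegral_rpow_le_add hq0 hη.le).trans (add_le_add h1 le_rfl)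
  have hscale : ∀ L : ℝ, 0 < L → ∀ t : ℝ, ‖L⁻¹ * t‖ₑ = (ENNReal.ofReal L)⁻¹ * ‖t‖ₑ := by
    intro L hL t
    rw [enorm_mul, Real.enorm_eq_ofReal_abs, abs_of_pos (inv_pos.2 hL),
      ENNReal.ofReal_inv_of_pos hL]
  have hLpos : ∀ L : ℝ, 0 < L → (0 : ℝ≥0∞) < (ENNReal.ofReal L)⁻¹ ∧
      (ENNReal.ofReal L)⁻¹ < ∞ := fun L hL =>
    ⟨ENNReal.inv_pos.2 ENNReal.ofReal_ne_top, ENNReal.inv_lt_top.2 (ENNReal.ofReal_pos.2 hL)⟩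
  refine ⟨fun u hu => ?_, ?_, ?_⟩
  · have hlt : VarExp.MNorm μ s p u < ∞ := ENNReal.add_lt_top.2
      ⟨VarExp.LvarNorm_lt_top hp₀ (Eventually.of_forall fun x => ⟨(hpb x).1, (hpb x).2.1⟩) hu.2,
        hu.1⟩
    obtain ⟨L, hL, hL2⟩ := ENNReal.lt_iff_exists_real_btwn.1 hlt
    have hL0 : 0 < L := ENNReal.ofReal_pos.1 (lt_of_le_of_lt zero_le hL2.1)
    refine ⟨(ENNReal.ofReal L)⁻¹, (hLpos L hL0).1, (hLpos L hL0).2, ?_⟩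
    rw [VarExp.modular_eq hqfin]
    simp only [← hscale L hL0]
    exact (hnorm u L hL0 hL2.1).trans_lt hD'top.lt_top
  · obtain ⟨C, hC1, hC⟩ := VarExp.exists_one_le_rpow_ge hq₀ hD'top
    have hC0 : 0 < C := by linarith
    have hC0' : ENNReal.ofReal C ≠ 0 := (ENNReal.ofReal_pos.2 hC0).ne'
    refine ⟨ENNReal.ofReal C, ENNReal.ofReal_lt_top, fun u _ => ?_⟩
    refine le_of_forall_gt_imp_ge_of_dense fun a ha => ?_
    have ha' : VarExp.MNorm μ s p u < a / ENNReal.ofReal C := by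
      rwa [ENNReal.lt_div_iff_mul_lt (Or.inl hC0') (Or.inl ENNReal.ofReal_ne_top), mul_comm]
    obtain ⟨L, hL, hL1, hL2⟩ := ENNReal.lt_iff_exists_real_btwn.1 ha'
    have hL0 : 0 < L := ENNReal.ofReal_pos.1 (lt_of_le_of_lt zero_le hL1)
    have hLC : ENNReal.ofReal L * ENNReal.ofReal C ≤ a := by
      rw [ENNReal.lt_div_iff_mul_lt (Or.inl hC0') (Or.inl ENNReal.ofReal_ne_top)] at hL2
      exact hL2.le
    refine le_trans (VarExp.luxNorm_le (mul_ne_zero (ENNReal.ofReal_pos.2 hL0).ne' hC0')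
      (ENNReal.mul_ne_top ENNReal.ofReal_ne_top ENNReal.ofReal_ne_top) ?_) hLC
    have h1 := VarExp.lintegral_div_rpow_le_one hq₀ (hqb.mono fun x hx => hx.2.1) hC1
      ((hnorm u L hL0 hL1).trans hC)
    rw [VarExp.modular_eq hqfin]
    refine le_of_eq_of_le (lintegral_congr fun x => ?_) h1
    rw [hscale L hL0, div_eq_mul_inv, div_eq_mul_inv, ENNReal.mul_inv (Or.inr (by simp))
      (Or.inr hC0')]
    ring_nf
  · rintro u hu ⟨K, hK, huK⟩
    -- One `L > K` normalises the whole sequence, so the limit of the original functions is `L * v`.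
    obtain ⟨L, hL, hL1, hL2⟩ := ENNReal.lt_iff_exists_real_btwn.1 hK
    have hL0 : 0 < L := ENNReal.ofReal_pos.1 (lt_of_le_of_lt zero_le hL1)
    choose g N hg hN hgrad hgP huP using fun n =>
      VarExp.exists_normalized hpfin hL0 ((huK n).trans_lt hL1)
    have hUm : ∀ n, Measurable fun x => L⁻¹ * u n x := fun n => (u n).measurable.const_mul _
    obtain ⟨k, v, hk, hv, hlim⟩ := VarExp.exists_subseq_tendsto_ae hX
      (P := fun x => (p x).toReal) (S := fun x => (s x).toReal) hpm hp₀ (fun x => (hpb x).2.1)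
      hs₀ (fun x => (hsb x).2.1) hUm (fun n => (hg n).aemeasurable) hN hgrad hgP huP
    have hUD : ∀ n, ∫⁻ x, ‖L⁻¹ * u n x‖ₑ ^ ((q x).toReal + η) ∂μ ≤ D := fun n =>
      hint (fun x => L⁻¹ * u n x) (g n) (N n) (hUm n).aemeasurable (hg n).aemeasurable (hN n)
        (hgrad n) (hgP n) (huP n)
    have hqη : ∀ x, 0 < (q x).toReal + η := fun x => by positivity
    have htm : Measurable fun x => (q x).toReal + η := hqm.add_const η
    -- Fatou's lemma passes the uniform bound to the limit.
    have hvD : ∫⁻ x, ‖v x‖ₑ ^ ((q x).toReal + η) ∂μ ≤ D := by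
      refine (lintegral_mono_ae ?_).trans ((lintegral_liminf_le
        (u := atTop) (f := fun n x => ‖L⁻¹ * u (k n) x‖ₑ ^ ((q x).toReal + η))
        fun n => (hUm _).enorm.pow htm).trans ?_)
      · filter_upwards [hlim] with x hx
        have h1 := ((ENNReal.continuous_rpow_const (y := (q x).toReal + η)).tendsto _).comp
          hx.enorm
        exact h1.liminf_eq.ge
      · exact liminf_le_of_le (by isBoundedDefault)
          fun b hb => hb.exists.elim fun n hn => hn.trans (hUD _)
    have hLv : AEStronglyMeasurable (fun x => L * v x) μ := (hv.const_mul L).aestronglyMeasurable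
    have hcoe := AEEqFun.coeFn_mk _ hLv
    refine ⟨AEEqFun.mk _ hLv, ⟨(ENNReal.ofReal L)⁻¹, (hLpos L hL0).1, (hLpos L hL0).2, ?_⟩,
      k, hk, ?_⟩
    · rw [VarExp.modular_eq hqfin]
      refine lt_of_le_of_lt ?_ hD'top.lt_top
      refine le_trans (le_of_eq (lintegral_congr_ae ?_))
        ((VarExp.lintegral_rpow_le_add hq0 hη.le).trans (add_le_add_left hvD _))
      filter_upwards [hcoe] with x hx
      rw [hx, ← hscale L hL0, inv_mul_cancel_left₀ hL0.ne']
    · rw [ENNReal.tendsto_nhds_zero]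
      intro ε hε
      rcases eq_or_ne ε ∞ with rfl | hεtop
      · exact Eventually.of_forall fun _ => le_top
      -- With this factor, `|u (k n) - L * v| / ε = c * |L⁻¹ * u (k n) - v|`, so a norm at most `ε`
      -- follows once the modular of the right side is at most 1.
      set c := ENNReal.ofReal L / ε with hc
      have hctop : c ≠ ∞ := ENNReal.div_ne_top ENNReal.ofReal_ne_top hε.ne'
      have hdm : ∀ n, AEMeasurable (fun x => L⁻¹ * u (k n) x - v x) μ := fun n =>
        (hUm _).aemeasurable.sub hv
      have hVit := VarExp.tendsto_lintegral_rpow_zero (μ := μ) (q := fun x => (q x).toReal)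
        (w := fun n x => c * ‖L⁻¹ * u (k n) x - v x‖ₑ)
        (D := max 1 (2 * c) ^ (q₁ + η) * (D + D)) hqm hq₀ (hqb.mono fun x hx => hx.2) hη
        (ENNReal.mul_ne_top (ENNReal.rpow_ne_top_of_ne_zero
          (zero_lt_one.trans_le (le_max_left _ _)).ne'
          (max_ne_top ENNReal.one_ne_top (ENNReal.mul_ne_top (by simp) hctop)))
          (ENNReal.add_ne_top.2 ⟨hD, hD⟩))
        (fun n => (hdm n).enorm.const_mul c)
        (fun n => by
          calc ∫⁻ x, (c * ‖L⁻¹ * u (k n) x - v x‖ₑ) ^ ((q x).toReal + η) ∂μ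
              ≤ ∫⁻ x, (c * (‖L⁻¹ * u (k n) x‖ₑ + ‖v x‖ₑ)) ^ ((q x).toReal + η) ∂μ := by
                refine lintegral_mono fun x => ENNReal.rpow_le_rpow ?_ (hqη x).le
                gcongr
                exact enorm_sub_le
            _ ≤ _ := VarExp.lintegral_const_mul_add_rpow_le (hUm _).enorm.aemeasurable htm
                (hqb.mono fun x hx => ⟨(hqη x).le, add_le_add_left hx.2.2 η⟩) hctop
            _ ≤ _ := by gcongr; exact hUD _)
        (by
          filter_upwards [hlim] with x hx
          have h1 : Tendsto (fun n => L⁻¹ * u (k n) x - v x) atTop (𝓝 0) := by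
            simpa using hx.sub_const (v x)
          have h2 := ENNReal.Tendsto.const_mul (a := c) h1.enorm (Or.inr hctop)
          simpa using h2)
      rw [ENNReal.tendsto_nhds_zero] at hVit
      filter_upwards [hVit 1 one_pos] with n hn
      refine VarExp.luxNorm_le hε.ne' hεtop ?_
      rw [VarExp.modular_eq hqfin]
      refine le_of_eq_of_le (lintegral_congr_ae ?_) hn
      filter_upwards [AEEqFun.coeFn_sub (u (k n)) (AEEqFun.mk _ hLv), hcoe] with x hx1 hx2
      have h3 : L⁻¹ * u (k n) x - v x = L⁻¹ * (u (k n) x - L * v x) := by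
        field_simp
      rw [hx1, Pi.sub_apply, hx2]
      rw [h3, hscale L hL0, ← mul_assoc, hc, div_eq_mul_inv, div_eq_mul_inv,
        mul_right_comm (ENNReal.ofReal L), ENNReal.mul_inv_cancel (ENNReal.ofReal_pos.2 hL0).ne'
        ENNReal.ofReal_ne_top, one_mul, mul_comm]
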